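/- **Theorem 4.4.** Let $\mathcal H$ be a complex Hilbert space and let $A$ be a bounded self-adjoint operator on $\mathcal H$. Let $U_c(\mathcal H)=\{u : u \text{ unitary and } u-1 \text{ compact}\}$ be the unitary Fredholm group, a real Banach–Lie group (a submanifold of $1+\mathcal K(\mathcal H)$, where $\mathcal K(\mathcal H)$ is the space of compact operators with the operator norm) whose Lie algebra is the space of compact anti-hermitian operators. Let $\mathcal O_A=\{uAu^* : u\in U_c(\mathcal H)\}$, a subset of the affine real Banach space $A+\mathcal K(\mathcal H)_h$, where $\mathcal K(\mathcal H)_h$ is the space of compact self-adjoint operators, and let $\pi_A:U_c(\mathcal H)\to\mathcal O_A$, $\pi_A(u)=uAu^*$. Let $1\le n\le\infty$. Then the following are equivalent: 1. $\mathcal O_A$ is a complemented $C^n$ submanifold of $A+\mathcal K(\mathcal H)_h$ (that is, with the topology of the operator norm it carries the structure of a $C^n$ Banach manifold for which the inclusion in $A+\mathcal K(\mathcal H)_h$ looks in suitable $C^n$ charts around each point like the inclusion $v\mapsto(v,0)$ of a factor of a product of Banach spaces), and for this structure $\pi_A$ is a $C^n$ submersion (that is, in suitable $C^n$ charts around each point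 and its image it looks like the projection $(v,w)\mapsto v$ of a product of Banach spaces onto a factor). 2. The spectrum of $A$ is finite. In particular (the case $n=\infty$), $\mathcal O_A$ is a complemented smooth submanifold of $A+\mathcal K(\mathcal H)_h$ and $\pi_A$ is a smooth submersion if and only if the spectrum of $A$ is finite. -/

import Mathlib

open scoped Manifold ContDiff

universe u

noncomputable section

namespace FredholmOrbit

/-! ### The spaces of compact hermitian and compact anti-hermitian operators -/

section Spaces

variable (H : Type u) [NormedAddCommGroup H] [InnerProductSpace ℂ H] [CompleteSpace H]

/-- The real Banach space `K(H)_h` of compact self-adjoint operators, with the operator norm. -/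
def compactHerm : Submodule ℝ (H →L[ℂ] H) where
  carrier := {x | IsCompactOperator x ∧ star x = x}
  zero_mem' := ⟨isCompactOperator_zero, star_zero _⟩
  add_mem' := fun ha hb => ⟨ha.1.add hb.1, by rw [star_add, ha.2, hb.2]⟩
  smul_mem' := fun c x hx => ⟨hx.1.smul c, by rw [star_smul, hx.2]; simp⟩

/-- The real Banach space `K(H)_ah` of compact anti-hermitian operators, with the operator norm. -/
def compactAntiHerm : Submodule ℝ (H →L[ℂ] H) where
  carrier := {x | IsCompactOperator x ∧ star x = -x}
  zero_mem' := ⟨isCompactOperator_zero, by simp⟩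
  add_mem' := fun ha hb => ⟨ha.1.add hb.1, by rw [star_add, ha.2, hb.2, neg_add]⟩
  smul_mem' := fun c x hx => ⟨hx.1.smul c, by rw [star_smul, hx.2]; simp⟩

/-- The unitary Fredholm group `U_c(H) = {u : u unitary, u - 1 compact}`, with the topology of the
operator norm. -/
def fredholmUnitary : Set (H →L[ℂ] H) :=
  {u | u ∈ unitary (H →L[ℂ] H) ∧ IsCompactOperator (u - 1 : H →L[ℂ] H)}

end Spaces

variable {H : Type u} [NormedAddCommGroup H] [InnerProductSpace ℂ H] [CompleteSpace H]

theorem isCompactOperator_mul_left {x : H →L[ℂ] H} (a : H →L[ℂ] H) (hx : IsCompactOperator x) :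
    IsCompactOperator (a * x) :=
  hx.clm_comp a

theorem isCompactOperator_mul_right {x : H →L[ℂ] H} (a : H →L[ℂ] H) (hx : IsCompactOperator x) :
    IsCompactOperator (x * a) :=
  hx.comp_clm a

theorem isCompactOperator_neg {x : H →L[ℂ] H} (hx : IsCompactOperator x) :
    IsCompactOperator (-x) :=
  hx.neg

theorem isCompactOperator_add {x y : H →L[ℂ] H} (hx : IsCompactOperator x)
    (hy : IsCompactOperator y) : IsCompactOperator (x + y) :=
  hx.add hy

theorem fredholm_mul {u v : H →L[ℂ] H} (hu : u ∈ fredholmUnitary H) (hv : v ∈ fredholmUnitary H) :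
    u * v ∈ fredholmUnitary H := by
  refine ⟨Submonoid.mul_mem _ hu.1 hv.1, ?_⟩
  have : u * v - 1 = (u - 1) * v + (v - 1) := by noncomm_ring
  rw [this]
  exact isCompactOperator_add (isCompactOperator_mul_right _ hu.2) hv.2

theorem fredholm_star {u : H →L[ℂ] H} (hu : u ∈ fredholmUnitary H) : star u ∈ fredholmUnitary H := by
  refine ⟨Unitary.star_mem hu.1, ?_⟩
  have : star u - 1 = -(star u * (u - 1)) := by
    rw [mul_sub, Unitary.star_mul_self_of_mem hu.1]; simp
  rw [this]
  exact isCompactOperator_neg (isCompactOperator_mul_left _ hu.2)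

/-! ### The Banach-Lie group structure of the unitary Fredholm group

`U_c(H)` is a real Banach manifold modelled on its Lie algebra `K(H)_ah`. The charts are the left
translates `u ↦ c(g* u)` of the Cayley transform `c(w) = (w - 1)(w + 1)⁻¹`, which maps the open set
of those `w` in `U_c(H)` for which `w + 1` is invertible onto `K(H)_ah`; its inverse is
`x ↦ (1 + x)(1 - x)⁻¹`. Both maps are restrictions of analytic maps between open sets of operators,
so this is the structure of `U_c(H)` as a submanifold of `1 + K(H)`. -/

/-- The Cayley transform `(w - 1)(w + 1)⁻¹`. -/
def cayley (w : H →L[ℂ] H) : H →L[ℂ] H := (w - 1) * Ring.inverse (w + 1)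

/-- The inverse Cayley transform `(1 + x)(1 - x)⁻¹`. -/
def cayleyInv (x : H →L[ℂ] H) : H →L[ℂ] H := (1 + x) * Ring.inverse (1 - x)

theorem isUnit_one_sub {x : H →L[ℂ] H} (hx : star x = -x) : IsUnit (1 - x) := by
  have hs : IsSelfAdjoint (Complex.I • x) := by
    rw [IsSelfAdjoint, star_smul, hx]; simp
  have h : Complex.I ∉ spectrum ℂ (Complex.I • x) := fun h => by
    simpa using congrArg Complex.im (hs.mem_spectrum_eq_re h)
  rw [spectrum.notMem_iff] at h
  have e : algebraMap ℂ (H →L[ℂ] H) Complex.I - Complex.I • x = Complex.I • (1 - x) := by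
    rw [smul_sub, Algebra.algebraMap_eq_smul_one]
  rw [e] at h
  exact (isUnit_smul_iff (Units.mk0 Complex.I Complex.I_ne_zero) _).1 h

theorem isUnit_one_add {x : H →L[ℂ] H} (hx : star x = -x) : IsUnit (1 + x) := by
  have := isUnit_one_sub (x := -x) (by simp [hx])
  simpa using this

theorem cayley_mem {w : H →L[ℂ] H} (hw : w ∈ fredholmUnitary H) :
    cayley w ∈ compactAntiHerm H := by
  refine ⟨isCompactOperator_mul_right _ hw.2, ?_⟩
  by_cases h : IsUnit (w + 1)
  · obtain ⟨r, hr⟩ := h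
    have hinv : Ring.inverse (w + 1) = (↑r⁻¹ : H →L[ℂ] H) := by rw [← hr, Ring.inverse_unit]
    have h1 : (w + 1) * (↑r⁻¹ : H →L[ℂ] H) = 1 := by rw [← hr]; simp
    have h2 : (↑r⁻¹ : H →L[ℂ] H) * (w + 1) = 1 := by rw [← hr]; simp
    have hu : star w * w = 1 := Unitary.star_mul_self_of_mem hw.1
    have hstar : star (↑r⁻¹ : H →L[ℂ] H) * (star w + 1) = 1 := by
      have := congrArg star h1
      simpa using this
    have hq : (star w + 1) * w = w + 1 := by rw [add_mul, hu, one_mul, add_comm]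
    have hr' : star (↑r⁻¹ : H →L[ℂ] H) = w * (↑r⁻¹ : H →L[ℂ] H) := by
      calc star (↑r⁻¹ : H →L[ℂ] H)
          = star (↑r⁻¹ : H →L[ℂ] H) * ((w + 1) * (↑r⁻¹ : H →L[ℂ] H)) := by rw [h1, mul_one]
        _ = star (↑r⁻¹ : H →L[ℂ] H) * (star w + 1) * w * (↑r⁻¹ : H →L[ℂ] H) := by
            rw [← hq]; noncomm_ring
        _ = w * (↑r⁻¹ : H →L[ℂ] H) := by rw [hstar, one_mul]
    have hcomm : (↑r⁻¹ : H →L[ℂ] H) * (w - 1) = (w - 1) * (↑r⁻¹ : H →L[ℂ] H) := by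
      calc (↑r⁻¹ : H →L[ℂ] H) * (w - 1)
          = (↑r⁻¹ : H →L[ℂ] H) * (w - 1) * ((w + 1) * (↑r⁻¹ : H →L[ℂ] H)) := by
            rw [h1, mul_one]
        _ = ((↑r⁻¹ : H →L[ℂ] H) * (w + 1)) * (w - 1) * (↑r⁻¹ : H →L[ℂ] H) := by noncomm_ring
        _ = (w - 1) * (↑r⁻¹ : H →L[ℂ] H) := by rw [h2, one_mul]
    have hw2 : w * (↑r⁻¹ : H →L[ℂ] H) = (↑r⁻¹ : H →L[ℂ] H) * w := by
      have := hcomm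
      rw [mul_sub, sub_mul, mul_one, one_mul] at this
      exact (sub_left_inj.1 this).symm
    rw [cayley, hinv, star_mul, star_sub, star_one, hr', hw2]
    have hws : w * star w = 1 := Unitary.mul_star_self_of_mem hw.1
    calc (↑r⁻¹ : H →L[ℂ] H) * w * (star w - 1)
        = (↑r⁻¹ : H →L[ℂ] H) * (w * star w - w) := by noncomm_ring
      _ = -((↑r⁻¹ : H →L[ℂ] H) * (w - 1)) := by rw [hws]; noncomm_ring
      _ = -((w - 1) * (↑r⁻¹ : H →L[ℂ] H)) := by rw [hcomm]
  · simp [cayley, Ring.inverse_non_unit _ h]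

theorem cayleyInv_mem {x : H →L[ℂ] H} (hx : x ∈ compactAntiHerm H) :
    cayleyInv x ∈ fredholmUnitary H := by
  obtain ⟨r, hr⟩ := isUnit_one_sub hx.2
  obtain ⟨s, hs⟩ := isUnit_one_add hx.2
  have hinv : Ring.inverse (1 - x) = (↑r⁻¹ : H →L[ℂ] H) := by rw [← hr, Ring.inverse_unit]
  have hrs : star (↑r : H →L[ℂ] H) = ↑s := by rw [hr, hs, star_sub, hx.2]; simp
  have hsr : star (↑s : H →L[ℂ] H) = ↑r := by rw [hr, hs, star_add, hx.2]; simp [sub_eq_add_neg]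
  have hcomm : Commute r s := by
    apply Units.ext
    simp only [Units.val_mul, hr, hs]
    noncomm_ring
  have hstar : star r = s := Units.ext hrs
  have hstar' : star s = r := Units.ext hsr
  have e : cayleyInv x = ((s * r⁻¹ : (H →L[ℂ] H)ˣ) : H →L[ℂ] H) := by
    rw [cayleyInv, hinv, Units.val_mul, hs]
  have es : star (s * r⁻¹) = s⁻¹ * r := by rw [star_mul, star_inv, hstar, hstar']
  refine ⟨?_, ?_⟩
  · rw [e, Unitary.mem_iff, ← Units.coe_star, es, ← Units.val_mul, ← Units.val_mul]
    have c1 : s⁻¹ * r * (s * r⁻¹) = 1 := by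
      have := hcomm.eq
      calc s⁻¹ * r * (s * r⁻¹) = s⁻¹ * (r * s) * r⁻¹ := by group
        _ = 1 := by rw [this]; group
    have c2 : s * r⁻¹ * (s⁻¹ * r) = 1 := by
      have := hcomm.inv_inv.eq
      calc s * r⁻¹ * (s⁻¹ * r) = s * (r⁻¹ * s⁻¹) * r := by group
        _ = 1 := by rw [this]; group
    rw [c1, c2]; simp
  · have h1 : (1 - x) * (↑r⁻¹ : H →L[ℂ] H) = 1 := by rw [← hr]; simp
    have : cayleyInv x - 1 = x * ((2 : ℂ) • (↑r⁻¹ : H →L[ℂ] H)) := by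
      rw [cayleyInv, hinv]
      calc (1 + x) * (↑r⁻¹ : H →L[ℂ] H) - 1
          = (1 + x) * (↑r⁻¹ : H →L[ℂ] H) - (1 - x) * (↑r⁻¹ : H →L[ℂ] H) := by rw [h1]
        _ = x * ((2 : ℂ) • (↑r⁻¹ : H →L[ℂ] H)) := by
            rw [two_smul]; noncomm_ring
    rw [this]
    exact isCompactOperator_mul_right _ hx.1

theorem cayley_cayleyInv {x : H →L[ℂ] H} (hx : star x = -x) :
    IsUnit (cayleyInv x + 1) ∧ cayley (cayleyInv x) = x := by
  obtain ⟨r, hr⟩ := isUnit_one_sub hx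
  have hinv : Ring.inverse (1 - x) = (↑r⁻¹ : H →L[ℂ] H) := by rw [← hr, Ring.inverse_unit]
  have h1 : (1 - x) * (↑r⁻¹ : H →L[ℂ] H) = 1 := by rw [← hr]; simp
  have ha : cayleyInv x + 1 = (2 : ℂ) • (↑r⁻¹ : H →L[ℂ] H) := by
    rw [cayleyInv, hinv]
    calc (1 + x) * (↑r⁻¹ : H →L[ℂ] H) + 1
        = (1 + x) * (↑r⁻¹ : H →L[ℂ] H) + (1 - x) * (↑r⁻¹ : H →L[ℂ] H) := by rw [h1]
      _ = (2 : ℂ) • (↑r⁻¹ : H →L[ℂ] H) := by rw [two_smul]; noncomm_ring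
  have hb : cayleyInv x - 1 = x * ((2 : ℂ) • (↑r⁻¹ : H →L[ℂ] H)) := by
    rw [cayleyInv, hinv]
    calc (1 + x) * (↑r⁻¹ : H →L[ℂ] H) - 1
        = (1 + x) * (↑r⁻¹ : H →L[ℂ] H) - (1 - x) * (↑r⁻¹ : H →L[ℂ] H) := by rw [h1]
      _ = x * ((2 : ℂ) • (↑r⁻¹ : H →L[ℂ] H)) := by rw [two_smul]; noncomm_ring
  have hu : IsUnit (cayleyInv x + 1) := by
    rw [ha]
    exact (isUnit_smul_iff (Units.mk0 (2 : ℂ) two_ne_zero) _).2 (Units.isUnit _)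
  refine ⟨hu, ?_⟩
  rw [cayley, hb, ← ha, mul_assoc, Ring.mul_inverse_cancel _ hu, mul_one]

theorem cayleyInv_cayley {w : H →L[ℂ] H} (hw : IsUnit (w + 1)) : cayleyInv (cayley w) = w := by
  obtain ⟨r, hr⟩ := hw
  have hinv : Ring.inverse (w + 1) = (↑r⁻¹ : H →L[ℂ] H) := by rw [← hr, Ring.inverse_unit]
  have h1 : (w + 1) * (↑r⁻¹ : H →L[ℂ] H) = 1 := by rw [← hr]; simp
  have ha : 1 + cayley w = w * ((2 : ℂ) • (↑r⁻¹ : H →L[ℂ] H)) := by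
    rw [cayley, hinv]
    calc 1 + (w - 1) * (↑r⁻¹ : H →L[ℂ] H)
        = (w + 1) * (↑r⁻¹ : H →L[ℂ] H) + (w - 1) * (↑r⁻¹ : H →L[ℂ] H) := by rw [h1]
      _ = w * ((2 : ℂ) • (↑r⁻¹ : H →L[ℂ] H)) := by rw [two_smul]; noncomm_ring
  have hb : 1 - cayley w = (2 : ℂ) • (↑r⁻¹ : H →L[ℂ] H) := by
    rw [cayley, hinv]
    calc 1 - (w - 1) * (↑r⁻¹ : H →L[ℂ] H)
        = (w + 1) * (↑r⁻¹ : H →L[ℂ] H) - (w - 1) * (↑r⁻¹ : H →L[ℂ] H) := by rw [h1]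
      _ = (2 : ℂ) • (↑r⁻¹ : H →L[ℂ] H) := by rw [two_smul]; noncomm_ring
  have hu : IsUnit (1 - cayley w) := by
    rw [hb]
    exact (isUnit_smul_iff (Units.mk0 (2 : ℂ) two_ne_zero) _).2 (Units.isUnit _)
  rw [cayleyInv, ha, ← hb, mul_assoc, Ring.mul_inverse_cancel _ hu, mul_one]

/-- The Cayley chart of `U_c(H)` centred at `g`: it is `u ↦ c(g* u)`, defined where `g* u + 1` is
invertible, with values in the whole of `K(H)_ah`. -/
def cayleyChart (g : fredholmUnitary H) :
    OpenPartialHomeomorph (fredholmUnitary H) (compactAntiHerm H) where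
  toFun u := ⟨cayley (star g.1 * u.1), cayley_mem (fredholm_mul (fredholm_star g.2) u.2)⟩
  invFun x := ⟨g.1 * cayleyInv x.1, fredholm_mul g.2 (cayleyInv_mem x.2)⟩
  source := {u | IsUnit (star g.1 * u.1 + 1)}
  target := Set.univ
  map_source' := fun _ _ => Set.mem_univ _
  map_target' := fun x _ => by
    change IsUnit (star g.1 * (g.1 * cayleyInv x.1) + 1)
    rw [← mul_assoc, Unitary.star_mul_self_of_mem g.2.1, one_mul]
    exact (cayley_cayleyInv x.2.2).1
  left_inv' := fun u hu => by
    apply Subtype.ext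
    change g.1 * cayleyInv (cayley (star g.1 * u.1)) = u.1
    rw [cayleyInv_cayley hu, ← mul_assoc, Unitary.mul_star_self_of_mem g.2.1, one_mul]
  right_inv' := fun x _ => by
    apply Subtype.ext
    change cayley (star g.1 * (g.1 * cayleyInv x.1)) = x.1
    rw [← mul_assoc, Unitary.star_mul_self_of_mem g.2.1, one_mul]
    exact (cayley_cayleyInv x.2.2).2
  open_source := Units.isOpen.preimage (by fun_prop)
  open_target := isOpen_univ
  continuousOn_toFun := by
    rw [continuousOn_iff_continuous_domRestrict, continuous_induced_rng]
    refine continuous_iff_continuousAt.2 fun u => ?_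
    obtain ⟨r, hr⟩ := u.2
    have hc : Continuous fun v : {u : fredholmUnitary H | IsUnit (star g.1 * u.1 + 1)} =>
        star g.1 * v.1.1 + 1 := by fun_prop
    have hi : ContinuousAt Ring.inverse (star g.1 * u.1.1 + 1) := by
      rw [← hr]; exact NormedRing.inverse_continuousAt r
    have h2 : Continuous fun v : {u : fredholmUnitary H | IsUnit (star g.1 * u.1 + 1)} =>
        star g.1 * v.1.1 - 1 := by fun_prop
    exact h2.continuousAt.mul (ContinuousAt.comp (f := fun v :
      {u : fredholmUnitary H | IsUnit (star g.1 * u.1 + 1)} => star g.1 * v.1.1 + 1) hi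
      hc.continuousAt)
  continuousOn_invFun := by
    refine Continuous.continuousOn ?_
    rw [continuous_induced_rng]
    refine continuous_iff_continuousAt.2 fun x => ?_
    obtain ⟨r, hr⟩ := isUnit_one_sub x.2.2
    have hi : ContinuousAt Ring.inverse (1 - x.1) := by
      rw [← hr]; exact NormedRing.inverse_continuousAt r
    have hc : Continuous fun y : compactAntiHerm H => 1 - y.1 := by fun_prop
    have h2 : Continuous fun y : compactAntiHerm H => 1 + y.1 := by fun_prop
    exact continuousAt_const.mul (h2.continuousAt.mul
      (ContinuousAt.comp (f := fun y : compactAntiHerm H => 1 - y.1) hi hc.continuousAt))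

theorem mem_cayleyChart_source (g : fredholmUnitary H) : g ∈ (cayleyChart g).source := by
  change IsUnit (star g.1 * g.1 + 1)
  rw [Unitary.star_mul_self_of_mem g.2.1, one_add_one_eq_two]
  have := (isUnit_smul_iff (Units.mk0 (2 : ℂ) two_ne_zero) (1 : H →L[ℂ] H)).2 isUnit_one
  have e : (Units.mk0 (2 : ℂ) two_ne_zero) • (1 : H →L[ℂ] H) = 2 := by
    change (2 : ℂ) • (1 : H →L[ℂ] H) = 2
    rw [two_smul, one_add_one_eq_two]
  rwa [e] at this

instance : ChartedSpace (compactAntiHerm H) (fredholmUnitary H) where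
  atlas := Set.range cayleyChart
  chartAt := cayleyChart
  mem_chart_source := mem_cayleyChart_source
  chart_mem_atlas := fun g => ⟨g, rfl⟩

theorem contDiffOn_of_isometry_comp {E G : Type u} [NormedAddCommGroup E] [NormedSpace ℝ E]
    [NormedAddCommGroup G] [NormedSpace ℝ G] {F : Type u} [NormedAddCommGroup F]
    [NormedSpace ℝ F] [CompleteSpace F] (j : F →ₗᵢ[ℝ] G) {f : E → F} {s : Set E} (hs : IsOpen s)
    (n : ℕ) (h : ContDiffOn ℝ n (fun x => j (f x)) s) : ContDiffOn ℝ n f s := by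
  induction n generalizing F G with
  | zero =>
    simp only [Nat.cast_zero, contDiffOn_zero] at h ⊢
    exact (j.isometry.isEmbedding.isInducing.continuousOn_iff).2 h
  | succ n ih =>
    have hcl : IsClosed (LinearMap.range j.toLinearMap : Set G) :=
      j.isometry.isClosedEmbedding.isClosed_range
    have key : ∀ x ∈ s, ∃ D : E →L[ℝ] F, HasFDerivAt f D x ∧
        j.toContinuousLinearMap ∘L D = fderiv ℝ (fun x => j (f x)) x := by
      intro x hx
      have hd : HasFDerivAt (fun x => j (f x)) (fderiv ℝ (fun x => j (f x)) x) x :=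
        ((h.differentiableOn (by simp)).differentiableAt (hs.mem_nhds hx)).hasFDerivAt
      set D := fderiv ℝ (fun x => j (f x)) x with hD
      have hmem : ∀ v, D v ∈ LinearMap.range j.toLinearMap := by
        intro v
        have hl := (hd.hasLineDerivAt v).tendsto_slope_zero
        refine hcl.mem_of_tendsto hl (Filter.Eventually.of_forall fun t => ?_)
        refine ⟨t⁻¹ • (f (x + t • v) - f x), ?_⟩
        simp
      choose g hg using hmem
      have hg' : ∀ v, j (g v) = D v := hg
      let L : E →ₗ[ℝ] F :=
        { toFun := g
          map_add' := fun v w => j.injective (by simp [hg'])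
          map_smul' := fun c v => j.injective (by simp [hg']) }
      let D' : E →L[ℝ] F := L.mkContinuous ‖D‖ (fun v => by
        change ‖g v‖ ≤ _
        rw [← j.norm_map, hg']; exact D.le_opNorm v)
      refine ⟨D', ?_, ?_⟩
      · rw [hasFDerivAt_iff_isLittleO_nhds_zero] at hd ⊢
        refine (Asymptotics.isLittleO_norm_left.1 ?_)
        refine (Asymptotics.isLittleO_norm_left.2 hd).congr_left fun v => ?_
        rw [← j.norm_map]
        congr 1
        rw [map_sub, map_sub]
        change _ = _ - j (g v)
        rw [hg']
      · ext v; exact hg' v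
    rw [Nat.cast_succ, contDiffOn_succ_iff_fderiv_of_isOpen hs] at h ⊢
    refine ⟨fun x hx => (key x hx).choose_spec.1.differentiableAt.differentiableWithinAt,
      by simp, ?_⟩
    refine ih (j.postcomp (E := E) (σ₁₂ := RingHom.id ℝ)) (h.2.2.congr fun x hx => ?_)
    obtain ⟨D, h1, h2⟩ := key x hx
    rw [← h2, h1.fderiv]
    rfl

theorem isClosed_compactAntiHerm : IsClosed (compactAntiHerm H : Set (H →L[ℂ] H)) := by
  have h1 : IsClosed {x : H →L[ℂ] H | IsCompactOperator x} :=
    isClosed_setOfPred_isCompactOperator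
  exact h1.inter (isClosed_eq continuous_star continuous_neg)

instance : CompleteSpace (compactAntiHerm H) :=
  isClosed_compactAntiHerm.completeSpace_coe

instance (n : ℕ∞) : IsManifold 𝓘(ℝ, compactAntiHerm H) n (fredholmUnitary H) := by
  refine isManifold_of_contDiffOn _ _ _ ?_
  rintro _ _ ⟨g, rfl⟩ ⟨h, rfl⟩
  have hopen : IsOpen ((cayleyChart g).symm ≫ₕ cayleyChart h).source :=
    OpenPartialHomeomorph.open_source _
  have hset : 𝓘(ℝ, compactAntiHerm H).symm ⁻¹' ((cayleyChart g).symm ≫ₕ cayleyChart h).source ∩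
      Set.range 𝓘(ℝ, compactAntiHerm H) = ((cayleyChart g).symm ≫ₕ cayleyChart h).source := by
    simp
  rw [hset]
  refine contDiffOn_iff_forall_nat_le.2 fun m _ => ?_
  refine contDiffOn_of_isometry_comp (compactAntiHerm H).subtypeₗᵢ hopen m ?_
  intro x hx
  refine ContDiffAt.contDiffWithinAt ?_
  have hx2 : IsUnit (star h.1 * (g.1 * cayleyInv x.1) + 1) := by
    have := hx.2
    exact this
  have hval : ContDiff ℝ m (fun y : compactAntiHerm H => y.1) :=
    (compactAntiHerm H).subtypeL.contDiff
  have hinv : ContDiffAt ℝ m (fun y : compactAntiHerm H => cayleyInv y.1) x := by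
    obtain ⟨r, hr⟩ := isUnit_one_sub x.2.2
    have hr1 : ContDiffAt ℝ m Ring.inverse (1 - x.1) := by
      rw [← hr]; exact contDiffAt_ringInverse ℝ r
    exact (contDiffAt_const.add hval.contDiffAt).mul
      (ContDiffAt.comp (f := fun y : compactAntiHerm H => 1 - y.1) x hr1
        (contDiffAt_const.sub hval.contDiffAt))
  have hw : ContDiffAt ℝ m
      (fun y : compactAntiHerm H => star h.1 * (g.1 * cayleyInv y.1)) x :=
    contDiffAt_const.mul (contDiffAt_const.mul hinv)
  obtain ⟨r, hr⟩ := hx2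
  have hr1 : ContDiffAt ℝ m Ring.inverse (star h.1 * (g.1 * cayleyInv x.1) + 1) := by
    rw [← hr]; exact contDiffAt_ringInverse ℝ r
  exact (hw.sub contDiffAt_const).mul (ContDiffAt.comp
    (f := fun y : compactAntiHerm H => star h.1 * (g.1 * cayleyInv y.1) + 1) x hr1
    (hw.add contDiffAt_const))

/-! ### The affine Banach space `A + K(H)_h` -/

/-- The affine space `A + K(H)_h`, as a set of operators. -/
def affineHerm (A : H →L[ℂ] H) : Set (H →L[ℂ] H) := {b | b - A ∈ compactHerm H}

/-- The translation `b ↦ b - A` from `A + K(H)_h` onto `K(H)_h`. -/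
def affineHermHomeo (A : H →L[ℂ] H) : affineHerm A ≃ₜ compactHerm H where
  toFun b := ⟨b.1 - A, b.2⟩
  invFun x := ⟨A + x.1, by
    change A + x.1 - A ∈ compactHerm H
    rw [add_sub_cancel_left]; exact x.2⟩
  left_inv b := Subtype.ext (add_sub_cancel A b.1)
  right_inv x := Subtype.ext (add_sub_cancel_left A x.1)
  continuous_toFun := by fun_prop
  continuous_invFun := by fun_prop

/-- `A + K(H)_h` is a manifold modelled on `K(H)_h`, with the translation as its only chart. -/
instance (A : H →L[ℂ] H) : ChartedSpace (compactHerm H) (affineHerm A) :=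
  (affineHermHomeo A).toOpenPartialHomeomorph.singletonChartedSpace rfl

instance (A : H →L[ℂ] H) (n : ℕ∞) : IsManifold 𝓘(ℝ, compactHerm H) n (affineHerm A) :=
  (affineHermHomeo A).toOpenPartialHomeomorph.isManifold_singleton rfl

/-! ### The orbit -/

/-- The orbit `O_A = {u A u* : u ∈ U_c(H)}`, with the topology of the operator norm. -/
def orbit (A : H →L[ℂ] H) : Set (H →L[ℂ] H) :=
  {b | ∃ u ∈ fredholmUnitary H, u * A * star u = b}

/-- The map `π_A : U_c(H) → O_A`, `π_A(u) = u A u*`. -/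
def orbitMap (A : H →L[ℂ] H) (u : fredholmUnitary H) : orbit A :=
  ⟨u.1 * A * star u.1, u.1, u.2, rfl⟩

theorem orbit_subset {A : H →L[ℂ] H} (hA : IsSelfAdjoint A) : orbit A ⊆ affineHerm A := by
  rintro _ ⟨u, hu, rfl⟩
  refine ⟨?_, ?_⟩
  · have : u * A * star u - A = (u - 1) * (A * star u) + A * (star u - 1) := by noncomm_ring
    rw [this]
    exact isCompactOperator_add (isCompactOperator_mul_right _ hu.2)
      (isCompactOperator_mul_left _ (fredholm_star hu).2)
  · rw [star_sub, star_mul, star_mul, star_star, hA.star_eq, mul_assoc]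

/-- The inclusion of the orbit of a self-adjoint operator `A` in `A + K(H)_h`. -/
def orbitInclusion {A : H →L[ℂ] H} (hA : IsSelfAdjoint A) : orbit A → affineHerm A :=
  Set.inclusion (orbit_subset hA)

end FredholmOrbit

end

noncomputable section

set_option linter.unusedSectionVars false

/-! ### Calculus: a smooth inverse function theorem and changes of charts. -/

section Calculus

variable {E F : Type*} [NormedAddCommGroup E] [NormedSpace ℝ E] [NormedAddCommGroup F]
  [NormedSpace ℝ F]

/-! Everything turns on the commutator map `T x = x A - A x` from compact anti-hermitian to compact
hermitian operators. Up to a factor 2 it is the derivative of `u ↦ u A u*` at `1` in Cayley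
coordinates. Both conditions of the theorem amount to the existence of a bounded `G` with `T G T =
T`.

Finite spectrum gives such a `G`. With the spectral projections `p i` of `A`, the block `p i (T x) p
j` is `(j - i)` times `p i x p j`, so dividing blocks by `j - i` and killing the diagonal ones gives
`G` with also `G T G = G`, whose kernel commutes with `A` (`exists_generalizedInverse`). Hence the
Lie algebra splits as `range (G T) ⊕ ker T` and the hermitian space as `range T ⊕ ker G`. By the
inverse function theorem, `(x, y) ↦ c(x) (A + y) c(x)* - A`, with `c` the inverse Cayley transform,
`x` in `range (G T)` and `y` in `ker G`, is a local diffeomorphism at `0`. The orbit is the slice `y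
= 0`: a small `y` commuting with `A` for which `A + y` lies in the orbit must vanish, because the
finitely many spectral values have a positive gap (`eq_zero_of_add_mem_orbit`). Translating by the
group gives charts everywhere. Writing group elements as `u c(x) c(k)` with `k` in `ker T`, whose
factor `c(k)` commutes with `A`, shows that the orbit map is a submersion.

Conversely, a submersion has a right inverse `R` of its derivative and an immersion a left inverse
`L`, so `2 R L` is a generalized inverse of `T` (`finite_spectrum_of_isSubmersion`). If the spectrum
were infinite, it would contain `a ≠ b` arbitrarily close together. For approximate unit
eigenvectors `ξ`, `η`, the operator `y = ξ ⊗ η* - η ⊗ ξ*` then has a small commutator with `A`, so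
`x = G (T y)` is small. But `y - x` commutes with `A`, so its matrix entry between `ξ` and `η` is
small too, whereas that of `y` is close to `1`: a contradiction
(`finite_spectrum_of_generalizedInverse`). -/

theorem exists_openPartialHomeomorph_of_contDiffOn [CompleteSpace E] {f : E → F} {U : Set E}
    {a : E} (hU : IsOpen U) (ha : a ∈ U) (hf : ContDiffOn ℝ ∞ f U) (e : E ≃L[ℝ] F)
    (he : HasFDerivAt f (e : E →L[ℝ] F) a) :
    ∃ φ : OpenPartialHomeomorph E F, a ∈ φ.source ∧ φ.source ⊆ U ∧ (∀ x, φ x = f x) ∧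
      ContDiffOn ℝ ∞ φ.symm φ.target := by
  have hfa : ContDiffAt ℝ ∞ f a := hf.contDiffAt (hU.mem_nhds ha)
  -- Restricting to the open set where the derivative is invertible makes the inverse smooth on the
  -- whole target, not only at the image of `a`.
  set V : Set E := U ∩ fderiv ℝ f ⁻¹' Set.range ContinuousLinearEquiv.toContinuousLinearMap
    with hV
  have hVo : IsOpen V :=
    (hf.continuousOn_fderiv_of_isOpen hU (by simp)).isOpen_inter_preimage hU
      ContinuousLinearEquiv.isOpen
  let φ := hfa.toOpenPartialHomeomorph f he (by simp)
  have hφ : (φ : E → F) = f := rfl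
  refine ⟨φ.restrOpen V hVo, ?_, ?_, fun x => rfl, ?_⟩
  · refine ⟨hfa.mem_toOpenPartialHomeomorph_source he (by simp), ha, e, ?_⟩
    exact he.fderiv.symm
  · exact fun x hx => hx.2.1
  · intro y hy
    have hy' := (φ.restrOpen V hVo).map_target hy
    obtain ⟨e', he'⟩ := hy'.2.2
    refine ContDiffAt.contDiffWithinAt ?_
    have hc : ContDiffAt ℝ ∞ f ((φ.restrOpen V hVo).symm y) :=
      hf.contDiffAt (hU.mem_nhds hy'.2.1)
    refine (φ.restrOpen V hVo).contDiffAt_symm (f₀' := e') hy ?_ hc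
    rw [he']
    exact (hc.differentiableAt (by simp)).hasFDerivAt

theorem mem_contDiffGroupoid_of_contDiffOn {n : ℕ∞ω} {φ : OpenPartialHomeomorph E E}
    (h : ContDiffOn ℝ n φ φ.source) (h' : ContDiffOn ℝ n φ.symm φ.target) :
    φ ∈ contDiffGroupoid n 𝓘(ℝ, E) := by
  rw [contDiffGroupoid, mem_groupoid_of_pregroupoid]
  constructor <;> simpa [contDiffPregroupoid]

theorem trans_mem_maximalAtlas {X M : Type*} [TopologicalSpace X] [TopologicalSpace M]
    [ChartedSpace X M] {G : StructureGroupoid X} [HasGroupoid M G]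
    {e : OpenPartialHomeomorph M X} (he : e ∈ G.maximalAtlas M) {φ : OpenPartialHomeomorph X X}
    (hφ : φ ∈ G) : e ≫ₕ φ ∈ G.maximalAtlas M := by
  rw [mem_maximalAtlas_iff] at he ⊢
  intro e' he'
  obtain ⟨h1, h2⟩ := he e' he'
  constructor
  · rw [OpenPartialHomeomorph.trans_symm_eq_symm_trans_symm, OpenPartialHomeomorph.trans_assoc]
    exact G.trans (G.symm hφ) h1
  · rw [← OpenPartialHomeomorph.trans_assoc]
    exact G.trans h2 hφ

section Algebra

variable {R : Type*} [NormedRing R] [NormedAlgebra ℝ R] {a b : E → R} {a' b' d : E →L[ℝ] R} {x : E}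

theorem hasFDerivAt_mul_of_forall (ha : HasFDerivAt a a' x) (hb : HasFDerivAt b b' x)
    (h : ∀ v, d v = a x * b' v + a' v * b x) : HasFDerivAt (fun y => a y * b y) d x :=
  (ha.mul' hb).congr_fderiv (ContinuousLinearMap.ext fun v => by rw [h]; rfl)

theorem hasFDerivAt_ringInverse_comp [HasSummableGeomSeries R] (r : Rˣ) (hr : a x = r)
    (ha : HasFDerivAt a a' x) (h : ∀ v, d v = -(↑r⁻¹ * a' v * ↑r⁻¹)) :
    HasFDerivAt (fun y => Ring.inverse (a y)) d x := by
  have hi := hasFDerivAt_ringInverse (𝕜 := ℝ) r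
  rw [← hr] at hi
  refine (hi.comp x ha).congr_fderiv (ContinuousLinearMap.ext fun v => ?_)
  rw [h]
  simp

end Algebra

end Calculus

/-! ### Smoothness and derivatives of conjugation and product in Cayley coordinates. -/

namespace FredholmOrbit

section Isometry

variable {E F G : Type u} [NormedAddCommGroup E] [NormedSpace ℝ E] [NormedAddCommGroup G]
  [NormedSpace ℝ G] [NormedAddCommGroup F] [NormedSpace ℝ F]

/-- Smoothness of maps into the spaces of compact operators can thus be checked among all bounded
operators, where the product and the inverse are available. -/
theorem contDiffOn_infty_of_isometry_comp [CompleteSpace F] (j : F →ₗᵢ[ℝ] G) {f : E → F}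
    {s : Set E} (hs : IsOpen s) (h : ContDiffOn ℝ ∞ (fun x => j (f x)) s) :
    ContDiffOn ℝ ∞ f s :=
  contDiffOn_infty.2 fun n => contDiffOn_of_isometry_comp j hs n (contDiffOn_infty.1 h n)

theorem hasFDerivAt_of_isometry_comp (j : F →ₗᵢ[ℝ] G) {f : E → F} {f' : E →L[ℝ] F} {a : E}
    (h : HasFDerivAt (fun x => j (f x)) (j.toContinuousLinearMap ∘L f') a) :
    HasFDerivAt f f' a := by
  rw [hasFDerivAt_iff_isLittleO_nhds_zero] at h ⊢
  refine Asymptotics.isLittleO_norm_left.1 ?_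
  refine (Asymptotics.isLittleO_norm_left.2 h).congr_left fun v => ?_
  rw [← j.norm_map]
  simp

end Isometry

variable {H : Type u} [NormedAddCommGroup H] [InnerProductSpace ℂ H] [CompleteSpace H]

theorem isClosed_compactHerm : IsClosed (compactHerm H : Set (H →L[ℂ] H)) := by
  have h1 : IsClosed {x : H →L[ℂ] H | IsCompactOperator x} :=
    isClosed_setOfPred_isCompactOperator
  exact h1.inter (isClosed_eq continuous_star continuous_id)

instance : CompleteSpace (compactHerm H) :=
  isClosed_compactHerm.completeSpace_coe

theorem cayleyInv_zero : cayleyInv (0 : H →L[ℂ] H) = 1 := by simp [cayleyInv]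

theorem contDiff_cayleyInv : ContDiff ℝ ∞ fun x : compactAntiHerm H => cayleyInv x.1 := by
  have hval : ContDiff ℝ ∞ (fun y : compactAntiHerm H => y.1) :=
    (compactAntiHerm H).subtypeL.contDiff
  refine contDiff_iff_contDiffAt.2 fun x => ?_
  obtain ⟨r, hr⟩ := isUnit_one_sub x.2.2
  have hr1 : ContDiffAt ℝ ∞ Ring.inverse (1 - x.1) := by
    rw [← hr]; exact contDiffAt_ringInverse ℝ r
  exact (contDiffAt_const.add hval.contDiffAt).mul
    (ContDiffAt.comp (f := fun y : compactAntiHerm H => 1 - y.1) x hr1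
      (contDiffAt_const.sub hval.contDiffAt))

/-- To first order `(1 + x)(1 - x)⁻¹` is `1 + 2 x`; this is the source of every factor 2 in front of
`commutatorMap`. -/
theorem hasFDerivAt_cayleyInv : HasFDerivAt (fun x : compactAntiHerm H => cayleyInv x.1)
    ((2 : ℝ) • (compactAntiHerm H).subtypeL) 0 := by
  have hval : HasFDerivAt (fun y : compactAntiHerm H => y.1) (compactAntiHerm H).subtypeL 0 :=
    (compactAntiHerm H).subtypeL.hasFDerivAt
  have hi : HasFDerivAt (fun y : compactAntiHerm H => Ring.inverse (1 - y.1))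
      (compactAntiHerm H).subtypeL 0 :=
    hasFDerivAt_ringInverse_comp 1 (by simp) (hval.const_sub 1) (by simp)
  exact hasFDerivAt_mul_of_forall (hval.const_add 1) hi (by simp [two_smul])

theorem hasFDerivAt_star_cayleyInv :
    HasFDerivAt (fun x : compactAntiHerm H => star (cayleyInv x.1))
      ((-2 : ℝ) • (compactAntiHerm H).subtypeL) 0 := by
  have h := ((starL' ℝ : (H →L[ℂ] H) ≃L[ℝ] (H →L[ℂ] H)) :
    (H →L[ℂ] H) →L[ℝ] (H →L[ℂ] H)).hasFDerivAt.comp 0 (hasFDerivAt_cayleyInv (H := H))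
  refine h.congr_fderiv ?_
  ext1 x
  have := x.2.2
  simp [this]

theorem contDiff_star_cayleyInv :
    ContDiff ℝ ∞ fun x : compactAntiHerm H => star (cayleyInv x.1) :=
  ((starL' ℝ : (H →L[ℂ] H) ≃L[ℝ] (H →L[ℂ] H)) :
    (H →L[ℂ] H) →L[ℝ] (H →L[ℂ] H)).contDiff.comp contDiff_cayleyInv

theorem conj_sub_mem_compactHerm {A : H →L[ℂ] H} (hA : IsSelfAdjoint A) {u : H →L[ℂ] H}
    (hu : u ∈ fredholmUnitary H) {y : H →L[ℂ] H} (hy : y ∈ compactHerm H) :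
    u * (A + y) * star u - A ∈ compactHerm H := by
  have h1 := orbit_subset hA ⟨u, hu, rfl⟩
  have h2 : u * y * star u ∈ compactHerm H :=
    ⟨isCompactOperator_mul_right _ (isCompactOperator_mul_left _ hy.1), by
      rw [star_mul, star_mul, star_star, hy.2, mul_assoc]⟩
  have : u * (A + y) * star u - A = (u * A * star u - A) + u * y * star u := by noncomm_ring
  rw [this]
  exact add_mem h1 h2

/-- The map `(x, y) ↦ c(x) (A + y) c(x)* - A`, where `c` is the inverse Cayley transform. -/
def conjMap {A : H →L[ℂ] H} (hA : IsSelfAdjoint A) (z : compactAntiHerm H × compactHerm H) :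
    compactHerm H :=
  ⟨cayleyInv z.1.1 * (A + z.2.1) * star (cayleyInv z.1.1) - A,
    conj_sub_mem_compactHerm hA (cayleyInv_mem z.1.2) z.2.2⟩

/-- The commutator `x ↦ x A - A x` from compact anti-hermitian to compact hermitian operators. -/
def commutatorMap {A : H →L[ℂ] H} (hA : IsSelfAdjoint A) : compactAntiHerm H →L[ℝ] compactHerm H :=
  ((((ContinuousLinearMap.mul ℝ (H →L[ℂ] H)).flip A) - ContinuousLinearMap.mul ℝ (H →L[ℂ] H) A) ∘L
    (compactAntiHerm H).subtypeL).codRestrict (compactHerm H) fun x => by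
      refine ⟨?_, ?_⟩
      · simpa [sub_eq_add_neg] using isCompactOperator_add (isCompactOperator_mul_right A x.2.1)
          (isCompactOperator_neg (isCompactOperator_mul_left A x.2.1))
      · have := x.2.2
        simp [this, hA.star_eq]
        abel

@[simp]
theorem coe_commutatorMap {A : H →L[ℂ] H} (hA : IsSelfAdjoint A) (x : compactAntiHerm H) :
    (commutatorMap hA x : H →L[ℂ] H) = x.1 * A - A * x.1 := by
  simp [commutatorMap]

theorem conjMap_zero {A : H →L[ℂ] H} (hA : IsSelfAdjoint A) : conjMap hA 0 = 0 := by
  apply Subtype.ext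
  simp [conjMap, cayleyInv_zero]

theorem contDiff_conjMap {A : H →L[ℂ] H} (hA : IsSelfAdjoint A) : ContDiff ℝ ∞ (conjMap hA) := by
  rw [← contDiffOn_univ]
  refine contDiffOn_infty_of_isometry_comp (compactHerm H).subtypeₗᵢ isOpen_univ ?_
  rw [contDiffOn_univ]
  have h1 := (contDiff_cayleyInv (H := H)).comp
    (contDiff_fst (E := compactAntiHerm H) (F := compactHerm H) (𝕜 := ℝ))
  have h2 := (contDiff_star_cayleyInv (H := H)).comp
    (contDiff_fst (E := compactAntiHerm H) (F := compactHerm H) (𝕜 := ℝ))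
  have h3 := (compactHerm H).subtypeL.contDiff (n := ∞).comp
    (contDiff_snd (E := compactAntiHerm H) (F := compactHerm H) (𝕜 := ℝ))
  exact ((h1.mul (contDiff_const.add h3)).mul h2).sub contDiff_const

theorem hasFDerivAt_conjMap {A : H →L[ℂ] H} (hA : IsSelfAdjoint A) :
    HasFDerivAt (conjMap hA) (((2 : ℝ) • commutatorMap hA) ∘L
      ContinuousLinearMap.fst ℝ (compactAntiHerm H) (compactHerm H) +
      ContinuousLinearMap.snd ℝ (compactAntiHerm H) (compactHerm H)) 0 := by
  refine hasFDerivAt_of_isometry_comp (compactHerm H).subtypeₗᵢ ?_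
  have h1 : HasFDerivAt (fun z : compactAntiHerm H × compactHerm H => cayleyInv z.1.1)
      (((2 : ℝ) • (compactAntiHerm H).subtypeL) ∘L ContinuousLinearMap.fst ℝ _ _) 0 :=
    HasFDerivAt.comp (g := fun x : compactAntiHerm H => cayleyInv x.1)
    (f := Prod.fst) (0 : compactAntiHerm H × compactHerm H) hasFDerivAt_cayleyInv hasFDerivAt_fst
  have h2 : HasFDerivAt (fun z : compactAntiHerm H × compactHerm H => star (cayleyInv z.1.1))
      (((-2 : ℝ) • (compactAntiHerm H).subtypeL) ∘L ContinuousLinearMap.fst ℝ _ _) 0 :=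
    HasFDerivAt.comp (g := fun x : compactAntiHerm H => star (cayleyInv x.1))
    (f := Prod.fst) (0 : compactAntiHerm H × compactHerm H) hasFDerivAt_star_cayleyInv
    hasFDerivAt_fst
  have h3 : HasFDerivAt (fun z : compactAntiHerm H × compactHerm H => A + z.2.1)
      ((compactHerm H).subtypeL ∘L ContinuousLinearMap.snd ℝ _ _) 0 :=
    (HasFDerivAt.comp (g := fun x : compactHerm H => x.1) (f := Prod.snd)
      (0 : compactAntiHerm H × compactHerm H) (compactHerm H).subtypeL.hasFDerivAt
      hasFDerivAt_snd).const_add A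
  have h4 := hasFDerivAt_mul_of_forall (d := (compactHerm H).subtypeL ∘L
    ContinuousLinearMap.snd ℝ _ _ + (2 : ℝ) • ((ContinuousLinearMap.mul ℝ (H →L[ℂ] H)).flip A) ∘L
      (compactAntiHerm H).subtypeL ∘L ContinuousLinearMap.fst ℝ _ _) h1 h3
    (by simp [cayleyInv_zero])
  refine (hasFDerivAt_mul_of_forall h4 h2 fun z => ?_).sub_const A
  simp [cayleyInv_zero, smul_sub]
  abel

/-- The product `(x, k) ↦ c(x) c(k)` read in the Cayley chart at `1`. -/
def cayleyMul (z : compactAntiHerm H × compactAntiHerm H) : compactAntiHerm H :=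
  ⟨cayley (cayleyInv z.1.1 * cayleyInv z.2.1),
    cayley_mem (fredholm_mul (cayleyInv_mem z.1.2) (cayleyInv_mem z.2.2))⟩

theorem isOpen_isUnit_cayleyInv_mul : IsOpen {z : compactAntiHerm H × compactAntiHerm H |
    IsUnit (cayleyInv z.1.1 * cayleyInv z.2.1 + 1)} := by
  have hc := (contDiff_cayleyInv (H := H)).continuous
  exact Units.isOpen.preimage
    (((hc.comp continuous_fst).mul (hc.comp continuous_snd)).add continuous_const)

theorem isUnit_two : IsUnit (1 + 1 : H →L[ℂ] H) := by
  have := (isUnit_smul_iff (Units.mk0 (2 : ℂ) two_ne_zero) (1 : H →L[ℂ] H)).2 isUnit_one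
  have e : (Units.mk0 (2 : ℂ) two_ne_zero) • (1 : H →L[ℂ] H) = 1 + 1 := by
    change (2 : ℂ) • (1 : H →L[ℂ] H) = _
    rw [two_smul]
  rwa [e] at this

theorem cayleyMul_zero : cayleyMul (0 : compactAntiHerm H × compactAntiHerm H) = 0 := by
  apply Subtype.ext
  simp [cayleyMul, cayleyInv_zero, cayley]

theorem contDiffOn_cayleyMul : ContDiffOn ℝ ∞ (cayleyMul (H := H))
    {z | IsUnit (cayleyInv z.1.1 * cayleyInv z.2.1 + 1)} := by
  refine contDiffOn_infty_of_isometry_comp (compactAntiHerm H).subtypeₗᵢ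
    isOpen_isUnit_cayleyInv_mul ?_
  intro z hz
  have hw : ContDiffAt ℝ ∞ (fun z : compactAntiHerm H × compactAntiHerm H =>
      cayleyInv z.1.1 * cayleyInv z.2.1) z :=
    ((contDiff_cayleyInv (H := H)).comp contDiff_fst).contDiffAt.mul
      ((contDiff_cayleyInv (H := H)).comp contDiff_snd).contDiffAt
  obtain ⟨r, hr⟩ := hz
  have hr1 : ContDiffAt ℝ ∞ Ring.inverse (cayleyInv z.1.1 * cayleyInv z.2.1 + 1) := by
    rw [← hr]; exact contDiffAt_ringInverse ℝ r
  exact ((hw.sub contDiffAt_const).mul (ContDiffAt.comp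
    (f := fun z : compactAntiHerm H × compactAntiHerm H => cayleyInv z.1.1 * cayleyInv z.2.1 + 1)
    z hr1 (hw.add contDiffAt_const))).contDiffWithinAt

/-- To first order the product in a Lie group is addition, and the Cayley chart undoes the factor 2
of its inverse. -/
theorem hasFDerivAt_cayleyMul : HasFDerivAt (cayleyMul (H := H))
    (ContinuousLinearMap.fst ℝ (compactAntiHerm H) (compactAntiHerm H) +
      ContinuousLinearMap.snd ℝ (compactAntiHerm H) (compactAntiHerm H)) 0 := by
  refine hasFDerivAt_of_isometry_comp (compactAntiHerm H).subtypeₗᵢ ?_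
  have h1 : HasFDerivAt (fun z : compactAntiHerm H × compactAntiHerm H => cayleyInv z.1.1)
      (((2 : ℝ) • (compactAntiHerm H).subtypeL) ∘L ContinuousLinearMap.fst ℝ _ _) 0 :=
    HasFDerivAt.comp (g := fun x : compactAntiHerm H => cayleyInv x.1)
    (f := Prod.fst) (0 : compactAntiHerm H × compactAntiHerm H) hasFDerivAt_cayleyInv
    hasFDerivAt_fst
  have h2 : HasFDerivAt (fun z : compactAntiHerm H × compactAntiHerm H => cayleyInv z.2.1)
      (((2 : ℝ) • (compactAntiHerm H).subtypeL) ∘L ContinuousLinearMap.snd ℝ _ _) 0 :=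
    HasFDerivAt.comp (g := fun x : compactAntiHerm H => cayleyInv x.1)
    (f := Prod.snd) (0 : compactAntiHerm H × compactAntiHerm H) hasFDerivAt_cayleyInv
    hasFDerivAt_snd
  have h3 := hasFDerivAt_mul_of_forall (d := (2 : ℝ) • (compactAntiHerm H).subtypeL ∘L
    (ContinuousLinearMap.fst ℝ _ _ + ContinuousLinearMap.snd ℝ _ _)) h1 h2
    (fun v => by simp [cayleyInv_zero]; abel)
  obtain ⟨r, hr⟩ := isUnit_two (H := H)
  have hi := hasFDerivAt_ringInverse_comp (d := (-ContinuousLinearMap.mulLeftRight ℝ _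
    (↑r⁻¹ : H →L[ℂ] H) ↑r⁻¹) ∘L ((2 : ℝ) • (compactAntiHerm H).subtypeL ∘L
    (ContinuousLinearMap.fst ℝ _ _ + ContinuousLinearMap.snd ℝ _ _))) r
    (by simp [cayleyInv_zero, hr]) (h3.add_const 1) fun v => by
      simp [-smul_add]
      rw [mul_add, add_mul, ← neg_add, smul_neg]
  refine hasFDerivAt_mul_of_forall (h3.sub_const 1) hi fun z => ?_
  have h4 : ∀ t : H →L[ℂ] H, t * Ring.inverse (1 + 1) + t * Ring.inverse (1 + 1) = t := by
    intro t
    rw [← mul_two, mul_assoc, ← one_add_one_eq_two, Ring.inverse_mul_cancel _ isUnit_two, mul_one]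
  simp [cayleyInv_zero, two_smul, add_mul, h4]

end FredholmOrbit

/-! ### Spectral resolution, isolation of the orbit in the commutant, and the generalized inverse.
-/

namespace FredholmOrbit

variable {H : Type u} [NormedAddCommGroup H] [InnerProductSpace ℂ H] [CompleteSpace H]

/-- `p` is a family of orthogonal projections, indexed by the finite set `S` of reals, which sum to
`1` and on whose ranges `A` acts as multiplication by the index. -/
structure IsSpectralResolution (A : H →L[ℂ] H) (S : Finset ℝ) (p : ℝ → H →L[ℂ] H) : Prop where
  star_eq : ∀ i, star (p i) = p i
  mul_self : ∀ i, p i * p i = p i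
  mul_ne : ∀ i j, i ≠ j → p i * p j = 0
  sum_eq : ∑ i ∈ S, p i = 1
  mul_left : ∀ i, A * p i = i • p i
  mul_right : ∀ i, p i * A = i • p i

/-- Every function is continuous on a finite set, so the continuous functional calculus applies to
indicators of points. For a point outside the spectrum this gives the zero projection, so most
fields of the structure need no membership in `S`. -/
theorem exists_isSpectralResolution {A : H →L[ℂ] H} (hA : IsSelfAdjoint A)
    (h : (spectrum ℂ A).Finite) : ∃ S p, IsSpectralResolution A S p := by
  have hfin : (spectrum ℝ A).Finite := by
    rw [← spectrum.preimage_algebraMap ℂ (R := ℝ)]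
    exact h.preimage (algebraMap ℝ ℂ).injective.injOn
  have hc : ∀ f : ℝ → ℝ, ContinuousOn f (spectrum ℝ A) := fun f => hfin.continuousOn f
  have hid : cfc (fun t : ℝ => t) A = A := cfc_id' ℝ A
  refine ⟨hfin.toFinset, fun i => cfc (fun t => if t = i then (1 : ℝ) else 0) A,
    fun i => (cfc_predicate _ A : IsSelfAdjoint _), fun i => ?_, fun i j hij => ?_, ?_,
    fun i => ?_, fun i => ?_⟩
  · rw [← cfc_mul _ _ A (hc _) (hc _)]
    exact cfc_congr fun t _ => by simp
  · rw [← cfc_mul _ _ A (hc _) (hc _), ← cfc_zero ℝ A]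
    refine cfc_congr fun t _ => ?_
    by_cases ht : t = i <;> simp [ht, hij]
  · rw [← cfc_sum _ A _ (fun _ _ => hc _), ← cfc_one ℝ A]
    refine cfc_congr fun t ht => ?_
    simp [ht]
  · conv_lhs => enter [1]; rw [← hid]
    rw [← cfc_mul _ _ A (hc _) (hc _), ← cfc_smul _ _ A (hc _)]
    refine cfc_congr fun t _ => ?_
    by_cases ht : t = i <;> simp [ht]
  · conv_lhs => enter [2]; rw [← hid]
    rw [← cfc_mul _ _ A (hc _) (hc _), ← cfc_smul _ _ A (hc _)]
    refine cfc_congr fun t _ => ?_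
    by_cases ht : t = i <;> simp [ht]

namespace IsSpectralResolution

variable {A : H →L[ℂ] H} {S : Finset ℝ} {p : ℝ → H →L[ℂ] H} (hp : IsSpectralResolution A S p)

include hp

theorem ext {x y : H →L[ℂ] H} (h : ∀ i ∈ S, ∀ j ∈ S, p i * x * p j = p i * y * p j) : x = y := by
  have key : ∀ z : H →L[ℂ] H, z = ∑ i ∈ S, ∑ j ∈ S, p i * z * p j := fun z => by
    simp_rw [← Finset.mul_sum, hp.sum_eq, mul_one, ← Finset.sum_mul, hp.sum_eq, one_mul]
  rw [key x, key y]
  exact Finset.sum_congr rfl fun i hi => Finset.sum_congr rfl fun j hj => h i hi j hj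

theorem mul_commutator_mul (x : H →L[ℂ] H) (i j : ℝ) :
    p i * (x * A - A * x) * p j = (j - i) • (p i * x * p j) := by
  calc p i * (x * A - A * x) * p j = p i * x * (A * p j) - p i * A * x * p j := by noncomm_ring
    _ = _ := by
      rw [hp.mul_left, hp.mul_right, sub_smul, mul_smul_comm, smul_mul_assoc, smul_mul_assoc]

/-- An operator commuting with `A` has vanishing off-diagonal blocks, since these get multiplied by
`j - i ≠ 0`. -/
theorem commute_of_commute {y : H →L[ℂ] H} (hy : A * y = y * A) (i : ℝ) : p i * y = y * p i := by
  have h0 : ∀ i j, i ≠ j → p i * y * p j = 0 := by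
    intro i j hij
    have := hp.mul_commutator_mul y i j
    rw [hy, sub_self, mul_zero, zero_mul] at this
    exact (smul_eq_zero.1 this.symm).resolve_left (sub_ne_zero.2 hij.symm)
  refine hp.ext fun k _ l _ => ?_
  rw [← mul_assoc, ← mul_assoc, mul_assoc _ (p i) (p l)]
  by_cases hki : k = i
  · subst hki
    rw [hp.mul_self]
    by_cases hkl : k = l
    · subst hkl; rw [hp.mul_self]
    · rw [hp.mul_ne _ _ hkl, h0 _ _ hkl, mul_zero]
  · rw [hp.mul_ne _ _ hki, zero_mul, zero_mul]
    by_cases hil : i = l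
    · subst hil; rw [hp.mul_self, h0 _ _ hki]
    · rw [hp.mul_ne _ _ hil, mul_zero]

/-- If `A + y = u A u*`, the operators `q j = u p j u*` are spectral projections of `A + y`. As `y`
commutes with `p k`, it acts on `p k q j` as the scalar `j - k`. For `j ≠ k` this scalar exceeds
`‖y‖`, which forces `p k q j = 0`; for `j = k` it is zero. Summing over both families gives `y = 0`.
-/
theorem eq_zero_of_add_mem_orbit {y : H →L[ℂ] H} (hy : A * y = y * A)
    (hS : ∀ i ∈ S, ∀ j ∈ S, i ≠ j → ‖y‖ < |i - j|) (h : A + y ∈ orbit A) : y = 0 := by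
  obtain ⟨u, hu, huA⟩ := h
  have hu1 : star u * u = 1 := Unitary.star_mul_self_of_mem hu.1
  have hu2 : u * star u = 1 := Unitary.mul_star_self_of_mem hu.1
  have hb : ∀ j, (A + y) * (u * p j * star u) = j • (u * p j * star u) := fun j => by
    rw [← huA]
    calc u * A * star u * (u * p j * star u) = u * A * (star u * u) * p j * star u := by
          noncomm_ring
      _ = u * (A * p j) * star u := by rw [hu1]; noncomm_ring
      _ = _ := by rw [hp.mul_left, mul_smul_comm, smul_mul_assoc]
  have hym : ∀ k j, y * (p k * (u * p j * star u)) = (j - k) • (p k * (u * p j * star u)) := by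
    intro k j
    calc y * (p k * (u * p j * star u)) = (y * p k) * (u * p j * star u) := by noncomm_ring
      _ = p k * y * (u * p j * star u) := by rw [hp.commute_of_commute hy]
      _ = p k * ((A + y) * (u * p j * star u)) - p k * A * (u * p j * star u) := by noncomm_ring
      _ = _ := by rw [hb, hp.mul_right, sub_smul, mul_smul_comm, smul_mul_assoc]
  have h0 : ∀ k ∈ S, ∀ j ∈ S, y * (p k * (u * p j * star u)) = 0 := by
    intro k hk j hj
    by_cases hkj : k = j
    · rw [hym, hkj, sub_self, zero_smul]
    · have h1 : |j - k| * ‖p k * (u * p j * star u)‖ ≤ ‖y‖ * ‖p k * (u * p j * star u)‖ := by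
        rw [← Real.norm_eq_abs, ← norm_smul, ← hym]
        exact norm_mul_le _ _
      have h2 := hS j hj k hk (Ne.symm hkj)
      have h3 : ‖p k * (u * p j * star u)‖ = 0 := by
        by_contra h4
        exact absurd (le_of_mul_le_mul_right h1 ((norm_nonneg _).lt_of_ne' h4)) (not_le.2 h2)
      rw [norm_eq_zero.1 h3, mul_zero]
  calc y = y * ((∑ k ∈ S, p k) * (u * (∑ j ∈ S, p j) * star u)) := by
        rw [hp.sum_eq, mul_one, hu2, mul_one, mul_one]
    _ = ∑ k ∈ S, ∑ j ∈ S, y * (p k * (u * p j * star u)) := by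
        simp only [Finset.sum_mul, Finset.mul_sum]
        rw [Finset.sum_comm]
    _ = 0 := Finset.sum_eq_zero fun k hk => Finset.sum_eq_zero fun j hj => h0 k hk j hj

theorem exists_pos_forall_eq_zero : ∃ ε > 0, ∀ y : H →L[ℂ] H, ‖y‖ < ε → A * y = y * A →
    A + y ∈ orbit A → y = 0 := by
  -- A positive `ε` below all the gaps; the filter avoids a separate case when `S` has at most one
  -- element and there is no minimum to take.
  have h : ∀ᶠ ε in nhdsWithin (0 : ℝ) (Set.Ioi 0), ∀ q ∈ S.offDiag, ε ≤ |q.1 - q.2| := by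
    rw [Filter.eventually_all_finset]
    intro q hq
    have : 0 < |q.1 - q.2| := abs_pos.2 (sub_ne_zero.2 (Finset.mem_offDiag.1 hq).2.2)
    exact nhdsWithin_le_nhds (Iic_mem_nhds this)
  obtain ⟨ε, h1, h2⟩ := (h.and self_mem_nhdsWithin).exists
  exact ⟨ε, h2, fun y hy hc ho => hp.eq_zero_of_add_mem_orbit hc
    (fun i hi j hj hij => hy.trans_le (h1 (i, j) (Finset.mem_offDiag.2 ⟨hi, hj, hij⟩))) ho⟩

omit hp in
/-- The Schur multiplier with symbol `(j - i)⁻¹` relative to the family `p`. -/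
def divDiff (S : Finset ℝ) (p : ℝ → H →L[ℂ] H) : (H →L[ℂ] H) →L[ℝ] (H →L[ℂ] H) :=
  ∑ i ∈ S, ∑ j ∈ S, (j - i)⁻¹ • ContinuousLinearMap.mulLeftRight ℝ (H →L[ℂ] H) (p i) (p j)

omit hp in
theorem divDiff_apply (z : H →L[ℂ] H) :
    divDiff S p z = ∑ i ∈ S, ∑ j ∈ S, (j - i)⁻¹ • (p i * z * p j) := by
  simp [divDiff]

theorem mul_divDiff_mul (z : H →L[ℂ] H) {k l : ℝ} (hk : k ∈ S) (hl : l ∈ S) :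
    p k * divDiff S p z * p l = (l - k)⁻¹ • (p k * z * p l) := by
  rw [divDiff_apply]
  simp only [Finset.mul_sum, Finset.sum_mul]
  have e : ∀ i j, p k * ((j - i)⁻¹ • (p i * z * p j)) * p l =
      (j - i)⁻¹ • ((p k * p i) * z * (p j * p l)) := fun i j => by
    rw [mul_smul_comm, smul_mul_assoc]; simp only [mul_assoc]
  simp_rw [e]
  rw [Finset.sum_eq_single_of_mem k hk, Finset.sum_eq_single_of_mem l hl, hp.mul_self, hp.mul_self]
  · intro j _ hj
    rw [hp.mul_ne j l hj, mul_zero, smul_zero]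
  · intro i _ hi
    refine Finset.sum_eq_zero fun j _ => ?_
    rw [hp.mul_ne k i hi.symm, zero_mul, zero_mul, smul_zero]

/-- The symbol `(j - i)⁻¹` is real and changes sign when `i` and `j` are exchanged, which turns
hermitian operators into anti-hermitian ones. -/
theorem divDiff_mem {z : H →L[ℂ] H} (hz : z ∈ compactHerm H) :
    divDiff S p z ∈ compactAntiHerm H := by
  refine ⟨?_, ?_⟩
  · have : ∀ w : H →L[ℂ] H, w ∈ (compactOperator (RingHom.id ℂ) H H) ↔ IsCompactOperator w :=
      fun _ => Iff.rfl
    rw [← this, divDiff_apply]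
    refine Submodule.sum_mem _ fun i _ => Submodule.sum_mem _ fun j _ => ?_
    rw [this]
    exact (isCompactOperator_mul_right _ (isCompactOperator_mul_left _ hz.1)).smul _
  · rw [divDiff_apply]
    simp only [star_sum, ← Finset.sum_neg_distrib]
    rw [Finset.sum_comm]
    refine Finset.sum_congr rfl fun i _ => Finset.sum_congr rfl fun j _ => ?_
    rw [star_smul, star_mul, star_mul, hp.star_eq, hp.star_eq, hz.2, star_trivial, ← neg_sub j i,
      inv_neg, neg_smul, mul_assoc]

end IsSpectralResolution

theorem exists_generalizedInverse {A : H →L[ℂ] H} (hA : IsSelfAdjoint A) {S : Finset ℝ}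
    {p : ℝ → H →L[ℂ] H} (hp : IsSpectralResolution A S p) :
    ∃ G : compactHerm H →L[ℝ] compactAntiHerm H,
      (∀ x, commutatorMap hA (G (commutatorMap hA x)) = commutatorMap hA x) ∧
      (∀ z, G (commutatorMap hA (G z)) = G z) ∧
      ∀ z, G z = 0 → A * z.1 = z.1 * A := by
  refine ⟨((IsSpectralResolution.divDiff S p) ∘L (compactHerm H).subtypeL).codRestrict
    (compactAntiHerm H) fun z => hp.divDiff_mem z.2, fun x => ?_, fun z => ?_, fun z hz => ?_⟩
  · refine Subtype.ext (hp.ext fun i hi j hj => ?_)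
    rw [coe_commutatorMap, hp.mul_commutator_mul]
    change (j - i) • (p i * IsSpectralResolution.divDiff S p (commutatorMap hA x).1 * p j) = _
    rw [hp.mul_divDiff_mul _ hi hj, coe_commutatorMap, hp.mul_commutator_mul, smul_smul, smul_smul]
    -- On diagonal blocks the convention `0⁻¹ = 0` makes both sides zero.
    rcases eq_or_ne (j - i) 0 with h | h
    · rw [h]; simp
    · rw [mul_inv_cancel₀ h, one_mul]
  · refine Subtype.ext (hp.ext fun i hi j hj => ?_)
    change p i * IsSpectralResolution.divDiff S p (commutatorMap hA _).1 * p j =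
      p i * IsSpectralResolution.divDiff S p z.1 * p j
    rw [hp.mul_divDiff_mul _ hi hj, coe_commutatorMap, hp.mul_commutator_mul]
    change (j - i)⁻¹ • (j - i) • (p i * IsSpectralResolution.divDiff S p z.1 * p j) = _
    rw [hp.mul_divDiff_mul _ hi hj, smul_smul, smul_smul]
    rcases eq_or_ne (j - i) 0 with h | h
    · rw [h]; simp
    · rw [inv_mul_cancel₀ h, one_mul]
  · refine hp.ext fun i hi j hj => ?_
    have h1 : IsSpectralResolution.divDiff S p z.1 = 0 := congrArg Subtype.val hz
    have h2 := hp.mul_divDiff_mul z.1 hi hj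
    have h3 := hp.mul_commutator_mul z.1 i j
    -- A scalar and its inverse vanish together, so a block killed by `(j - i)⁻¹` is also killed by
    -- `j - i`; hence all blocks of the commutator vanish.
    rw [h1, mul_zero, zero_mul, eq_comm, smul_eq_zero, inv_eq_zero, ← smul_eq_zero, ← h3] at h2
    rw [mul_sub, sub_mul, sub_eq_zero] at h2
    exact h2.symm

end FredholmOrbit

/-! ### Topological splittings given by a generalized inverse. -/

section GeneralizedInverse

variable {E F : Type*} [NormedAddCommGroup E] [NormedSpace ℝ E] [NormedAddCommGroup F]
  [NormedSpace ℝ F] {T : E →L[ℝ] F} {G : F →L[ℝ] E}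

/-- The range of the idempotent `G ∘ T`, when `G` is a generalized inverse of `T`. -/
def corange (T : E →L[ℝ] F) (G : F →L[ℝ] E) : Submodule ℝ E :=
  LinearMap.ker (ContinuousLinearMap.id ℝ E - G ∘L T).toLinearMap

theorem mem_corange {x : E} : x ∈ corange T G ↔ G (T x) = x := by
  simp [corange, sub_eq_zero, eq_comm (a := x)]

theorem isClosed_corange : IsClosed (corange T G : Set E) :=
  (ContinuousLinearMap.id ℝ E - G ∘L T).isClosed_ker

/-- The kernel of a continuous linear map, as a submodule. -/
abbrev kernel (T : E →L[ℝ] F) : Submodule ℝ E := LinearMap.ker T.toLinearMap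

theorem mem_kernel {x : E} : x ∈ kernel T ↔ T x = 0 := Iff.rfl

/-- If `G` is a generalized inverse of `T`, then `(x, k) ↦ x + k` is an isomorphism of the product
of the range of `G ∘ T` and the kernel of `T` onto the domain of `T`. -/
def corangeProdKernel (h1 : ∀ x, T (G (T x)) = T x) :
    (corange T G × kernel T) ≃L[ℝ] E :=
  ContinuousLinearEquiv.equivOfInverse
    ((corange T G).subtypeL ∘L ContinuousLinearMap.fst ℝ _ _ +
      (kernel T).subtypeL ∘L ContinuousLinearMap.snd ℝ _ _)
    (((G ∘L T).codRestrict (corange T G) fun x => mem_corange.2 (by simp [h1])).prod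
      ((ContinuousLinearMap.id ℝ E - G ∘L T).codRestrict (kernel T) fun x =>
        mem_kernel.2 (by simp [h1])))
    (fun z => by
      have e1 : G (T z.1) = z.1 := mem_corange.1 z.1.2
      have e2 : T z.2 = 0 := z.2.2
      refine Prod.ext (Subtype.ext ?_) (Subtype.ext ?_) <;> simp [e1, e2])
    (fun z => by simp)

/-- If `G` is a generalized inverse of `T`, then `(x, y) ↦ 2 T x + y` is an isomorphism of the
product of the range of `G ∘ T` and the kernel of `G` onto the codomain of `T`. -/
def corangeProdKernelInv (h2 : ∀ y, G (T (G y)) = G y) :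
    (corange T G × kernel G) ≃L[ℝ] F :=
  ContinuousLinearEquiv.equivOfInverse
    -- The factor 2 makes this isomorphism equal to the derivative at `0` of the slice
    -- parametrization, when `T` is the commutator map.
    (((2 : ℝ) • T) ∘L (corange T G).subtypeL ∘L ContinuousLinearMap.fst ℝ _ _ +
      (kernel G).subtypeL ∘L ContinuousLinearMap.snd ℝ _ _)
    ((((2 : ℝ)⁻¹ • G).codRestrict (corange T G) fun x => mem_corange.2 (by simp [h2])).prod
      ((ContinuousLinearMap.id ℝ F - T ∘L G).codRestrict (kernel G) fun x =>
        mem_kernel.2 (by simp [h2])))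
    (fun z => by
      have e1 : G (T z.1) = z.1 := mem_corange.1 z.1.2
      have e2 : G z.2 = 0 := z.2.2
      refine Prod.ext (Subtype.ext ?_) (Subtype.ext ?_) <;> simp [e1, e2])
    (fun z => by simp)

instance [CompleteSpace E] : CompleteSpace (corange T G) :=
  isClosed_corange.completeSpace_coe

instance [CompleteSpace E] : CompleteSpace (kernel T) :=
  T.isClosed_ker.completeSpace_coe

end GeneralizedInverse

/-! ### Slices for the orbit and the charts obtained by translating them. -/

namespace FredholmOrbit

variable {H : Type u} [NormedAddCommGroup H] [InnerProductSpace ℂ H] [CompleteSpace H]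

theorem conj_mem_orbit {A u b : H →L[ℂ] H} (hu : u ∈ fredholmUnitary H) (hb : b ∈ orbit A) :
    u * b * star u ∈ orbit A := by
  obtain ⟨v, hv, rfl⟩ := hb
  exact ⟨u * v, fredholm_mul hu hv, by rw [star_mul]; noncomm_ring⟩

/-- A local parametrization of `A + K(H)_h` near `A` by `(x, y) ↦ c(x) (A + y) c(x)*`, with
`x` and `y` in given subspaces, in which the orbit of `A` is given by the equation `y = 0`. -/
structure OrbitSlice {A : H →L[ℂ] H} (hA : IsSelfAdjoint A) {M N : Type u}
    [NormedAddCommGroup M] [NormedSpace ℝ M] [NormedAddCommGroup N] [NormedSpace ℝ N]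
    (j : M →L[ℝ] compactAntiHerm H) (l : N →L[ℝ] compactHerm H) where
  /-- The parametrization. -/
  Φ : OpenPartialHomeomorph (M × N) (compactHerm H)
  zero_mem : 0 ∈ Φ.source
  apply_eq : ∀ z, Φ z = conjMap hA (j z.1, l z.2)
  contDiffOn_symm : ContDiffOn ℝ ∞ Φ.symm Φ.target
  snd_eq_zero : ∀ z ∈ Φ.source, A + (Φ z).1 ∈ orbit A → z.2 = 0

section Slice

variable {M N : Type u} [NormedAddCommGroup M] [NormedSpace ℝ M] [NormedAddCommGroup N]
  [NormedSpace ℝ N]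

theorem contDiff_conjMap_comp {A : H →L[ℂ] H} (hA : IsSelfAdjoint A)
    (j : M →L[ℝ] compactAntiHerm H) (l : N →L[ℝ] compactHerm H) :
    ContDiff ℝ ∞ fun z : M × N => conjMap hA (j z.1, l z.2) :=
  (contDiff_conjMap hA).comp
    ((j.contDiff.comp contDiff_fst).prodMk (l.contDiff.comp contDiff_snd))

/-- The hypothesis `he` says that `e` is the derivative of the parametrization at `0`, so the
inverse function theorem applies; `hl` and the spectral gap isolate the orbit. -/
theorem nonempty_orbitSlice [CompleteSpace M] [CompleteSpace N] {A : H →L[ℂ] H}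
    (hA : IsSelfAdjoint A) {S : Finset ℝ} {p : ℝ → H →L[ℂ] H} (hp : IsSpectralResolution A S p)
    {j : M →L[ℝ] compactAntiHerm H} {l : N →L[ℝ] compactHerm H}
    (e : (M × N) ≃L[ℝ] compactHerm H)
    (he : ∀ z, e z = (2 : ℝ) • commutatorMap hA (j z.1) + l z.2)
    (hl : ∀ y, A * (l y).1 = (l y).1 * A) : Nonempty (OrbitSlice hA j l) := by
  obtain ⟨ε, hε, hy⟩ := hp.exists_pos_forall_eq_zero
  have hU : IsOpen {z : M × N | ‖l z.2‖ < ε} := isOpen_lt (by fun_prop) continuous_const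
  have hd : HasFDerivAt (fun z : M × N => conjMap hA (j z.1, l z.2))
      (e : M × N →L[ℝ] compactHerm H) 0 := by
    have h0 : ((j (0 : M × N).1, l (0 : M × N).2) : compactAntiHerm H × compactHerm H) = 0 := by
      simp
    refine (HasFDerivAt.comp (g := conjMap hA) (f := fun z : M × N => (j z.1, l z.2))
      (0 : M × N) (h0 ▸ hasFDerivAt_conjMap hA)
      ((j.hasFDerivAt.comp (0 : M × N) hasFDerivAt_fst).prodMk
        (l.hasFDerivAt.comp (0 : M × N) hasFDerivAt_snd))).congr_fderiv
      (ContinuousLinearMap.ext fun z => ?_)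
    exact (he z).symm
  obtain ⟨Φ, h0, hs, ha, hc⟩ := exists_openPartialHomeomorph_of_contDiffOn hU (by simpa using hε)
    (contDiff_conjMap_comp hA j l).contDiffOn e hd
  refine ⟨⟨Φ, h0, ha, hc, fun z hz ho => ?_⟩⟩
  have hu := cayleyInv_mem (j z.1).2
  have := conj_mem_orbit (fredholm_star hu) ho
  -- Undoing the conjugation by `c(j x)` stays in the orbit and leaves `A + l y`, to which the
  -- spectral gap applies.
  have e1 : star (cayleyInv (j z.1).1) * (A + (Φ z).1) * star (star (cayleyInv (j z.1).1)) =
      A + (l z.2).1 := by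
    rw [ha, star_star]
    change star (cayleyInv (j z.1).1) * (A + (cayleyInv (j z.1).1 * (A + (l z.2).1) *
      star (cayleyInv (j z.1).1) - A)) * cayleyInv (j z.1).1 = _
    rw [add_sub_cancel]
    calc _ = (star (cayleyInv (j z.1).1) * cayleyInv (j z.1).1) * (A + (l z.2).1) *
          (star (cayleyInv (j z.1).1) * cayleyInv (j z.1).1) := by noncomm_ring
      _ = _ := by rw [Unitary.star_mul_self_of_mem hu.1, one_mul, mul_one]
  rw [e1] at this
  have h1 : l z.2 = 0 := Subtype.ext (hy _ (hs hz) (hl _) this)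
  have h2 : e (0, z.2) = 0 := by rw [he, h1]; simp
  exact congrArg Prod.snd ((map_eq_zero_iff e e.injective).1 h2)

end Slice

/-- The affine action `z ↦ v (A + z) v* - A` of `U_c(H)` on `K(H)_h`. -/
def affineAct {A : H →L[ℂ] H} (hA : IsSelfAdjoint A) (v : fredholmUnitary H)
    (z : compactHerm H) : compactHerm H :=
  ⟨v.1 * (A + z.1) * star v.1 - A, conj_sub_mem_compactHerm hA v.2 z.2⟩

theorem contDiff_affineAct {A : H →L[ℂ] H} (hA : IsSelfAdjoint A) (v : fredholmUnitary H) :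
    ContDiff ℝ ∞ (affineAct hA v) := by
  rw [← contDiffOn_univ]
  refine contDiffOn_infty_of_isometry_comp (compactHerm H).subtypeₗᵢ isOpen_univ ?_
  rw [contDiffOn_univ]
  exact ((contDiff_const.mul (contDiff_const.add (compactHerm H).subtypeL.contDiff)).mul
    contDiff_const).sub contDiff_const

/-- The inverse of an element of `U_c(H)`. -/
def starUnitary (v : fredholmUnitary H) : fredholmUnitary H := ⟨star v.1, fredholm_star v.2⟩

theorem affineAct_starUnitary_affineAct {A : H →L[ℂ] H} (hA : IsSelfAdjoint A)
    (v : fredholmUnitary H) (z : compactHerm H) :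
    affineAct hA (starUnitary v) (affineAct hA v z) = z := by
  apply Subtype.ext
  change star v.1 * (A + (v.1 * (A + z.1) * star v.1 - A)) * star (star v.1) - A = z.1
  rw [add_sub_cancel, star_star, sub_eq_iff_eq_add, add_comm z.1]
  calc _ = (star v.1 * v.1) * (A + z.1) * (star v.1 * v.1) := by noncomm_ring
    _ = _ := by rw [Unitary.star_mul_self_of_mem v.2.1, one_mul, mul_one]

theorem starUnitary_starUnitary (v : fredholmUnitary H) : starUnitary (starUnitary v) = v :=
  Subtype.ext (star_star _)

/-- The affine action of an element of `U_c(H)` as a homeomorphism. -/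
def affineActHomeo {A : H →L[ℂ] H} (hA : IsSelfAdjoint A) (v : fredholmUnitary H) :
    compactHerm H ≃ₜ compactHerm H where
  toFun := affineAct hA v
  invFun := affineAct hA (starUnitary v)
  left_inv := affineAct_starUnitary_affineAct hA v
  right_inv z := by
    simpa [starUnitary_starUnitary] using affineAct_starUnitary_affineAct hA (starUnitary v) z
  continuous_toFun := (contDiff_affineAct hA v).continuous
  continuous_invFun := (contDiff_affineAct hA _).continuous

/-- The inverse Cayley transform with values in `U_c(H)`. -/
def cayleyInvUnitary (x : compactAntiHerm H) : fredholmUnitary H :=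
  ⟨cayleyInv x.1, cayleyInv_mem x.2⟩

/-- The product in `U_c(H)`. -/
def mulUnitary (u v : fredholmUnitary H) : fredholmUnitary H := ⟨u.1 * v.1, fredholm_mul u.2 v.2⟩

theorem affineHermHomeo_orbitInclusion {A : H →L[ℂ] H} (hA : IsSelfAdjoint A)
    (u : fredholmUnitary H) (x : compactAntiHerm H) :
    affineHermHomeo A (orbitInclusion hA (orbitMap A (mulUnitary u (cayleyInvUnitary x)))) =
      affineAct hA u (conjMap hA (x, 0)) := by
  apply Subtype.ext
  change u.1 * cayleyInv x.1 * A * star (u.1 * cayleyInv x.1) - A =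
    u.1 * (A + (cayleyInv x.1 * (A + 0) * star (cayleyInv x.1) - A)) * star u.1 - A
  rw [star_mul]
  noncomm_ring

theorem continuous_orbitMap (A : H →L[ℂ] H) : Continuous (orbitMap A) :=
  Continuous.subtype_mk (by fun_prop) _

theorem isEmbedding_orbitInclusion {A : H →L[ℂ] H} (hA : IsSelfAdjoint A) :
    Topology.IsEmbedding (orbitInclusion hA) :=
  Topology.IsEmbedding.inclusion (orbit_subset hA)

namespace OrbitSlice

variable {A : H →L[ℂ] H} {hA : IsSelfAdjoint A} {M N : Type u} [NormedAddCommGroup M]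
  [NormedSpace ℝ M] [NormedAddCommGroup N] [NormedSpace ℝ N] {j : M →L[ℝ] compactAntiHerm H}
  {l : N →L[ℝ] compactHerm H} (s : OrbitSlice hA j l)

theorem apply_zero : s.Φ 0 = 0 := by
  rw [s.apply_eq, Prod.fst_zero, Prod.snd_zero, map_zero, map_zero]
  exact conjMap_zero hA

/-- The translate by `u` of the inverse of the parametrization, as a chart of `A + K(H)_h`. -/
def ambientChart (u : fredholmUnitary H) : OpenPartialHomeomorph (affineHerm A) (M × N) :=
  (affineHermHomeo A).toOpenPartialHomeomorph ≫ₕ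
    ((affineActHomeo hA (starUnitary u)).toOpenPartialHomeomorph ≫ₕ s.Φ.symm)

theorem ambientChart_apply (u : fredholmUnitary H) (b : affineHerm A) :
    s.ambientChart u b = s.Φ.symm (affineAct hA (starUnitary u) (affineHermHomeo A b)) := rfl

theorem mem_ambientChart_source {u : fredholmUnitary H} {b : affineHerm A} :
    b ∈ (s.ambientChart u).source ↔
      affineAct hA (starUnitary u) (affineHermHomeo A b) ∈ s.Φ.target := by
  simp [ambientChart, affineActHomeo]

theorem snd_ambientChart {u : fredholmUnitary H} {b : orbit A}
    (hb : orbitInclusion hA b ∈ (s.ambientChart u).source) :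
    (s.ambientChart u (orbitInclusion hA b)).2 = 0 := by
  rw [mem_ambientChart_source] at hb
  refine s.snd_eq_zero _ (s.Φ.map_target hb) ?_
  rw [ambientChart_apply, s.Φ.right_inv hb]
  change A + (star u.1 * (A + (b.1 - A)) * star (star u.1) - A) ∈ orbit A
  rw [add_sub_cancel, add_sub_cancel]
  exact conj_mem_orbit (fredholm_star u.2) b.2

theorem affineAct_orbitMap (u : fredholmUnitary H) (x : M) :
    affineAct hA (starUnitary u) (affineHermHomeo A (orbitInclusion hA
      (orbitMap A (mulUnitary u (cayleyInvUnitary (j x)))))) = s.Φ (x, 0) := by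
  rw [affineHermHomeo_orbitInclusion, affineAct_starUnitary_affineAct, s.apply_eq, map_zero]

theorem mem_source_of_mem {u : fredholmUnitary H} {x : M} (hx : ((x, 0) : M × N) ∈ s.Φ.source) :
    orbitInclusion hA (orbitMap A (mulUnitary u (cayleyInvUnitary (j x)))) ∈
      (s.ambientChart u).source := by
  rw [mem_ambientChart_source, s.affineAct_orbitMap]
  exact s.Φ.map_source hx

theorem ambientChart_orbitMap {u : fredholmUnitary H} {x : M}
    (hx : ((x, 0) : M × N) ∈ s.Φ.source) :
    s.ambientChart u (orbitInclusion hA (orbitMap A (mulUnitary u (cayleyInvUnitary (j x))))) =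
      (x, 0) := by
  rw [ambientChart_apply, s.affineAct_orbitMap, s.Φ.left_inv hx]

/-- The chart of the orbit centred at `u A u*`. -/
def orbitChart (u : fredholmUnitary H) : OpenPartialHomeomorph (orbit A) M where
  toFun b := (s.ambientChart u (orbitInclusion hA b)).1
  invFun x := orbitMap A (mulUnitary u (cayleyInvUnitary (j x)))
  source := orbitInclusion hA ⁻¹' (s.ambientChart u).source
  target := {x | ((x, 0) : M × N) ∈ s.Φ.source}
  map_source' b hb := by
    have h1 := s.Φ.map_target (s.mem_ambientChart_source.1 hb)
    have h2 := s.snd_ambientChart hb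
    change (((s.ambientChart u (orbitInclusion hA b)).1, 0) : M × N) ∈ s.Φ.source
    rwa [← h2, Prod.mk.eta]
  map_target' x hx := s.mem_source_of_mem hx
  left_inv' b hb := by
    have h2 := s.snd_ambientChart hb
    have h1 := s.Φ.map_target (s.mem_ambientChart_source.1 hb)
    rw [← ambientChart_apply, ← Prod.mk.eta (p := s.ambientChart u _), h2] at h1
    apply (isEmbedding_orbitInclusion hA).injective
    -- Both points of the orbit have the same coordinates `(x, 0)` in the ambient chart, which is
    -- injective.
    refine (s.ambientChart u).injOn (s.mem_source_of_mem h1) hb ?_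
    rw [s.ambientChart_orbitMap h1, ← h2]
  right_inv' x hx := by rw [s.ambientChart_orbitMap hx]
  open_source := (s.ambientChart u).open_source.preimage
    (isEmbedding_orbitInclusion hA).continuous
  open_target := s.Φ.open_source.preimage (by fun_prop)
  continuousOn_toFun := continuous_fst.comp_continuousOn ((s.ambientChart u).continuousOn.comp
    (isEmbedding_orbitInclusion hA).continuous.continuousOn fun _ hb => hb)
  continuousOn_invFun := by
    have h1 : Continuous fun x : M => mulUnitary u (cayleyInvUnitary (j x)) :=
      Continuous.subtype_mk (continuous_const.mul
        (contDiff_cayleyInv.continuous.comp j.continuous)) _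
    exact ((continuous_orbitMap A).comp h1).continuousOn

theorem orbitMap_mem_orbitChart_source (u : fredholmUnitary H) :
    orbitMap A u ∈ (s.orbitChart u).source := by
  have h := s.mem_source_of_mem (u := u) (x := 0) s.zero_mem
  have e : mulUnitary u (cayleyInvUnitary (j (0 : M))) = u := by
    apply Subtype.ext
    change u.1 * cayleyInv (j 0).1 = u.1
    rw [map_zero, ZeroMemClass.coe_zero, cayleyInv_zero, mul_one]
  rwa [e] at h

theorem exists_orbitMap_eq (b : orbit A) : ∃ u, orbitMap A u = b := by
  obtain ⟨u, hu, h⟩ := b.2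
  exact ⟨⟨u, hu⟩, Subtype.ext h⟩

/-- The charts `orbitChart u` form an atlas of the orbit. -/
abbrev chartedSpace : ChartedSpace M (orbit A) where
  atlas := Set.range s.orbitChart
  chartAt b := s.orbitChart (exists_orbitMap_eq b).choose
  mem_chart_source b := by
    have := s.orbitMap_mem_orbitChart_source (exists_orbitMap_eq b).choose
    rwa [(exists_orbitMap_eq b).choose_spec] at this
  chart_mem_atlas _ := ⟨_, rfl⟩

/-- A change of charts is the first component of the smooth `Φ.symm` applied to a map given by
products of operators, so it is smooth. -/
theorem contDiffOn_orbitChart_symm_trans (u v : fredholmUnitary H) :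
    ContDiffOn ℝ ∞ ((s.orbitChart u).symm ≫ₕ s.orbitChart v)
      ((s.orbitChart u).symm ≫ₕ s.orbitChart v).source := by
  have h0 : ContDiff ℝ ∞ fun x : M => ((j x, 0) : compactAntiHerm H × compactHerm H) :=
    j.contDiff.prodMk contDiff_const
  have h1 : ContDiff ℝ ∞ fun x : M => affineAct hA (starUnitary v)
      (affineAct hA u (conjMap hA (j x, 0))) :=
    (contDiff_affineAct hA _).comp ((contDiff_affineAct hA u).comp ((contDiff_conjMap hA).comp h0))
  have h2 : ∀ x : M, affineAct hA (starUnitary v) (affineHermHomeo A (orbitInclusion hA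
      ((s.orbitChart u).symm x))) =
      affineAct hA (starUnitary v) (affineAct hA u (conjMap hA (j x, 0))) := fun x => by
    rw [← affineHermHomeo_orbitInclusion]; rfl
  refine (contDiff_fst.comp_contDiffOn (s.contDiffOn_symm.comp h1.contDiffOn fun x hx => ?_)).congr
    fun x hx => ?_
  · have := s.mem_ambientChart_source.1 hx.2
    rwa [← h2]
  · change (s.ambientChart v (orbitInclusion hA ((s.orbitChart u).symm x))).1 = _
    rw [ambientChart_apply, h2]
    rfl

theorem isManifold (n : ℕ∞) : @IsManifold ℝ _ _ _ _ _ _ 𝓘(ℝ, M) n (orbit A) _ s.chartedSpace := by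
  let := s.chartedSpace
  refine isManifold_of_contDiffOn _ _ _ ?_
  rintro _ _ ⟨u, rfl⟩ ⟨v, rfl⟩
  refine ((s.contDiffOn_orbitChart_symm_trans u v).of_le (by exact_mod_cast le_top)).congr_mono
    (fun _ _ => rfl) ?_
  intro x hx
  exact hx.1

end OrbitSlice

end FredholmOrbit

/-! ### Finite spectrum implies the embedding and the submersion. -/

namespace FredholmOrbit

variable {H : Type u} [NormedAddCommGroup H] [InnerProductSpace ℂ H] [CompleteSpace H]

theorem cayleyInv_commute {A x : H →L[ℂ] H} (h : x * A = A * x) :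
    cayleyInv x * A = A * cayleyInv x := by
  have h1 : Commute (1 - x) A := (Commute.one_left A).sub_left h
  have h2 : Commute (1 + x) A := (Commute.one_left A).add_left h
  have h3 : Commute (Ring.inverse (1 - x)) A := by
    by_cases hu : IsUnit (1 - x)
    · obtain ⟨r, hr⟩ := hu
      rw [← hr, Ring.inverse_unit]
      exact (hr ▸ h1 : Commute (r : H →L[ℂ] H) A).units_inv_left
    · rw [Ring.inverse_non_unit _ hu]
      exact Commute.zero_left A
  exact (h2.mul_left h3).eq

namespace OrbitSlice

variable {A : H →L[ℂ] H} {hA : IsSelfAdjoint A} {M N : Type u} [NormedAddCommGroup M]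
  [NormedSpace ℝ M] [NormedAddCommGroup N] [NormedSpace ℝ N] {j : M →L[ℝ] compactAntiHerm H}
  {l : N →L[ℝ] compactHerm H} (s : OrbitSlice hA j l)

/-- The chart `ambientChart u`, followed by a linear isomorphism onto the model space. -/
def modelChart (e : (M × N) ≃L[ℝ] compactHerm H) (u : fredholmUnitary H) :
    OpenPartialHomeomorph (affineHerm A) (compactHerm H) :=
  (affineHermHomeo A).toOpenPartialHomeomorph ≫ₕ
    ((affineActHomeo hA (starUnitary u)).toOpenPartialHomeomorph ≫ₕ
      (s.Φ.symm ≫ₕ e.toHomeomorph.toOpenPartialHomeomorph))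

theorem mem_modelChart_source {e : (M × N) ≃L[ℝ] compactHerm H} {u : fredholmUnitary H}
    {b : affineHerm A} :
    b ∈ (s.modelChart e u).source ↔ b ∈ (s.ambientChart u).source := by
  simp [modelChart, ambientChart]

theorem modelChart_mem_maximalAtlas (e : (M × N) ≃L[ℝ] compactHerm H) (u : fredholmUnitary H)
    (n : ℕ∞) :
    s.modelChart e u ∈ IsManifold.maximalAtlas 𝓘(ℝ, compactHerm H) n (affineHerm A) := by
  have hn : (n : ℕ∞ω) ≤ ∞ := by exact_mod_cast le_top
  have h0 : (affineHermHomeo A).toOpenPartialHomeomorph ∈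
      IsManifold.maximalAtlas 𝓘(ℝ, compactHerm H) n (affineHerm A) :=
    IsManifold.subset_maximalAtlas rfl
  refine trans_mem_maximalAtlas h0 (StructureGroupoid.trans _ ?_ ?_)
  · exact mem_contDiffGroupoid_of_contDiffOn ((contDiff_affineAct hA _).of_le hn).contDiffOn
      ((contDiff_affineAct hA _).of_le hn).contDiffOn
  · refine mem_contDiffGroupoid_of_contDiffOn ?_ ?_
    · exact (e.contDiff.comp_contDiffOn (s.contDiffOn_symm.of_le hn)).mono
        (Set.inter_subset_left (s := s.Φ.symm.source))
    · refine ContDiff.contDiffOn ?_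
      have : ContDiff ℝ n s.Φ := by
        rw [funext s.apply_eq]
        exact (contDiff_conjMap_comp hA j l).of_le hn
      exact ContDiff.comp (g := s.Φ) (f := e.symm) this e.symm.contDiff

/-- In the slice charts the inclusion is `x ↦ (x, 0)`, by `ambientChart_orbitMap`. -/
theorem isSmoothEmbedding (e : (M × N) ≃L[ℝ] compactHerm H) (n : ℕ∞) :
    @Manifold.IsSmoothEmbedding ℝ _ _ _ _ _ _ _ _ _ _ _ 𝓘(ℝ, M) 𝓘(ℝ, compactHerm H) _ _ _
      s.chartedSpace _ _ n (orbitInclusion hA) := by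
  let := s.chartedSpace
  have := s.isManifold n
  refine ⟨⟨N, inferInstance, inferInstance, fun b => ?_⟩, isEmbedding_orbitInclusion hA⟩
  obtain ⟨u, rfl⟩ := exists_orbitMap_eq b
  refine .mk_of_charts e (s.orbitChart u) (s.modelChart e u) (s.orbitMap_mem_orbitChart_source u)
    ?_ (IsManifold.subset_maximalAtlas ⟨u, rfl⟩) (s.modelChart_mem_maximalAtlas e u n) ?_ ?_
  · exact s.mem_modelChart_source.2 (s.orbitMap_mem_orbitChart_source u)
  · exact fun b hb => s.mem_modelChart_source.2 hb
  · intro x hx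
    have hx' : ((x, 0) : M × N) ∈ s.Φ.source := by
      change x ∈ (s.orbitChart u).target
      simpa using hx
    exact congrArg e (s.ambientChart_orbitMap (u := u) hx')

/-- Near `u`, group elements factor as `u c(j x) c(i k)`. The last factor commutes with `A` and
disappears from the orbit map, which becomes `(x, k) ↦ x`. -/
theorem isSubmersion {K : Type u} [NormedAddCommGroup K] [NormedSpace ℝ K] [CompleteSpace M]
    [CompleteSpace K] {i : K →L[ℝ] compactAntiHerm H} (hk : ∀ x, (i x).1 * A = A * (i x).1)
    (e : (M × K) ≃L[ℝ] compactAntiHerm H) (he : ∀ z, e z = j z.1 + i z.2) (n : ℕ∞) :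
    @Manifold.IsSubmersion ℝ _ _ _ _ _ _ _ _ _ _ _ 𝓘(ℝ, compactAntiHerm H) 𝓘(ℝ, M) _ _ _ _ _
      s.chartedSpace n (orbitMap A) := by
  let := s.chartedSpace
  have := s.isManifold n
  have hn : (n : ℕ∞ω) ≤ ∞ := by exact_mod_cast le_top
  let c : M × K → compactAntiHerm H × compactAntiHerm H := fun z => (j z.1, i z.2)
  have hc : ContDiff ℝ ∞ c := (j.contDiff.comp contDiff_fst).prodMk (i.contDiff.comp contDiff_snd)
  let U : Set (M × K) := {z | ((z.1, 0) : M × N) ∈ s.Φ.source} ∩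
    c ⁻¹' {z | IsUnit (cayleyInv z.1.1 * cayleyInv z.2.1 + 1)}
  have hU : IsOpen U := (s.Φ.open_source.preimage (by fun_prop)).inter
    (isOpen_isUnit_cayleyInv_mul.preimage hc.continuous)
  have h0 : (0 : M × K) ∈ U := by
    refine ⟨s.zero_mem, ?_⟩
    change IsUnit (cayleyInv (j 0).1 * cayleyInv (i 0).1 + 1)
    rw [map_zero, map_zero, ZeroMemClass.coe_zero, cayleyInv_zero, one_mul]
    exact isUnit_two
  have hsm : ContDiffOn ℝ ∞ (fun z => cayleyMul (c z)) U :=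
    contDiffOn_cayleyMul.comp hc.contDiffOn fun z hz => hz.2
  have hc0 : c 0 = 0 := by simp [c]
  have hd : HasFDerivAt (fun z => cayleyMul (c z)) (e : M × K →L[ℝ] compactAntiHerm H) 0 := by
    refine (HasFDerivAt.comp (g := cayleyMul) (f := c) (0 : M × K) (hc0 ▸ hasFDerivAt_cayleyMul)
      ((j.hasFDerivAt.comp (0 : M × K) hasFDerivAt_fst).prodMk
        (i.hasFDerivAt.comp (0 : M × K) hasFDerivAt_snd))).congr_fderiv
      (ContinuousLinearMap.ext fun z => ?_)
    exact (he z).symm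
  obtain ⟨Θ, hΘ0, hΘU, hΘ, hΘs⟩ := exists_openPartialHomeomorph_of_contDiffOn hU h0 hsm e hd
  have hΘz : Θ 0 = 0 := by rw [hΘ, hc0]; exact cayleyMul_zero
  refine ⟨K, inferInstance, inferInstance, fun u => ?_⟩
  -- Charts of the group must take values in its model space, so the coordinates `(x, k)` are
  -- transported back by `e`.
  let ψ : OpenPartialHomeomorph (compactAntiHerm H) (compactAntiHerm H) :=
    Θ.symm ≫ₕ e.toHomeomorph.toOpenPartialHomeomorph
  have hψ : ψ ∈ contDiffGroupoid n 𝓘(ℝ, compactAntiHerm H) := by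
    refine mem_contDiffGroupoid_of_contDiffOn ?_ ?_
    · exact (e.contDiff.comp_contDiffOn (hΘs.of_le hn)).mono fun x hx => hx.1
    · have h1 : ContDiffOn ℝ n Θ Θ.source := by
        rw [funext hΘ]
        exact (hsm.mono hΘU).of_le hn
      exact ContDiffOn.comp (g := Θ) (f := e.symm) h1 e.symm.contDiff.contDiffOn fun x hx => hx.2
  have key : ∀ z ∈ Θ.source, (cayleyChart u).symm (Θ z) =
      mulUnitary (mulUnitary u (cayleyInvUnitary (j z.1))) (cayleyInvUnitary (i z.2)) := by
    intro z hz
    apply Subtype.ext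
    change u.1 * cayleyInv (Θ z).1 = u.1 * cayleyInv (j z.1).1 * cayleyInv (i z.2).1
    rw [hΘ, mul_assoc]
    congr 1
    exact cayleyInv_cayley (hΘU hz).2
  have key2 : ∀ z ∈ Θ.source, orbitMap A ((cayleyChart u).symm (Θ z)) =
      orbitMap A (mulUnitary u (cayleyInvUnitary (j z.1))) := fun z hz => by
    rw [key z hz]
    apply Subtype.ext
    have h1 := cayleyInv_commute (hk z.2)
    have h2 := Unitary.mul_star_self_of_mem (cayleyInv_mem (i z.2).2).1
    change (u.1 * cayleyInv (j z.1).1 * cayleyInv (i z.2).1) * A *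
      star (u.1 * cayleyInv (j z.1).1 * cayleyInv (i z.2).1) = _
    rw [mul_assoc _ (cayleyInv (i z.2).1) A, h1, star_mul _ (cayleyInv (i z.2).1)]
    calc _ = u.1 * cayleyInv (j z.1).1 * A * (cayleyInv (i z.2).1 * star (cayleyInv (i z.2).1)) *
          star (u.1 * cayleyInv (j z.1).1) := by noncomm_ring
      _ = _ := by rw [h2, mul_one]; rfl
  have hchart : cayleyChart u ≫ₕ ψ ∈
      IsManifold.maximalAtlas 𝓘(ℝ, compactAntiHerm H) n (fredholmUnitary H) :=
    trans_mem_maximalAtlas (IsManifold.subset_maximalAtlas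
      (show cayleyChart u ∈ atlas (compactAntiHerm H) (fredholmUnitary H) from ⟨u, rfl⟩)) hψ
  refine .mk_of_charts e.symm (cayleyChart u ≫ₕ ψ) (s.orbitChart u) ?_
    (s.orbitMap_mem_orbitChart_source u) hchart (IsManifold.subset_maximalAtlas ⟨u, rfl⟩) ?_ ?_
  · refine ⟨mem_cayleyChart_source u, ?_, trivial⟩
    have : cayleyChart u u = 0 := by
      apply Subtype.ext
      change cayley (star u.1 * u.1) = 0
      rw [Unitary.star_mul_self_of_mem u.2.1, cayley, sub_self, zero_mul]
    change cayleyChart u u ∈ Θ.target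
    rw [this, ← hΘz]
    exact Θ.map_source hΘ0
  · rintro v ⟨hv1, hv2, -⟩
    have hz := Θ.map_target hv2
    have h3 := key2 _ hz
    have hv : (cayleyChart u).symm ((cayleyChart u).symm.symm v) = v :=
      (cayleyChart u).left_inv hv1
    rw [Θ.right_inv hv2, hv] at h3
    change orbitMap A v ∈ (s.orbitChart u).source
    rw [h3]
    exact s.mem_source_of_mem (hΘU hz).1
  · intro x hx
    have hx' : e.symm x ∈ Θ.source := by
      simpa [ψ, cayleyChart] using hx
    change (s.ambientChart u (orbitInclusion hA (orbitMap A
      ((cayleyChart u).symm (Θ (e.symm x)))))).1 = (e.symm x).1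
    rw [key2 _ hx', s.ambientChart_orbitMap (hΘU hx').1]

end OrbitSlice

theorem exists_chartedSpace_of_finite_spectrum {A : H →L[ℂ] H} (hA : IsSelfAdjoint A) (n : ℕ∞)
    (h : (spectrum ℂ A).Finite) :
    ∃ (E : Type u) (_ : NormedAddCommGroup E) (_ : NormedSpace ℝ E)
        (_ : ChartedSpace E (orbit A)),
      IsManifold 𝓘(ℝ, E) n (orbit A) ∧
      Manifold.IsSmoothEmbedding 𝓘(ℝ, E) 𝓘(ℝ, compactHerm H) n (orbitInclusion hA) ∧
      Manifold.IsSubmersion 𝓘(ℝ, compactAntiHerm H) 𝓘(ℝ, E) n (orbitMap A) := by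
  obtain ⟨S, p, hp⟩ := exists_isSpectralResolution hA h
  obtain ⟨G, h1, h2, h3⟩ := exists_generalizedInverse hA hp
  obtain ⟨s⟩ := nonempty_orbitSlice hA hp (j := (corange (commutatorMap hA) G).subtypeL)
    (l := (kernel G).subtypeL) (corangeProdKernelInv h2) (fun _ => rfl) fun y => h3 y y.2
  refine ⟨_, inferInstance, inferInstance, s.chartedSpace, s.isManifold n,
    s.isSmoothEmbedding (corangeProdKernelInv h2) n,
    s.isSubmersion (i := (kernel (commutatorMap hA)).subtypeL) (fun x => ?_)
      (corangeProdKernel h1) (fun _ => rfl) n⟩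
  have := congrArg Subtype.val (mem_kernel.1 x.2)
  rw [coe_commutatorMap] at this
  exact sub_eq_zero.1 this

end FredholmOrbit

/-! ### A bounded generalized inverse of the commutator map forces finite spectrum. -/

namespace FredholmOrbit

variable {H : Type u} [NormedAddCommGroup H] [InnerProductSpace ℂ H] [CompleteSpace H]

/-- Without approximate eigenvectors `t - A` is bounded below. Being self-adjoint and injective it
also has dense range, the orthogonal complement of the range being the kernel; so it is invertible.
-/
theorem exists_norm_sub_smul_lt {A : H →L[ℂ] H} (hA : IsSelfAdjoint A) {t : ℝ}
    (ht : t ∈ spectrum ℝ A) {ε : ℝ} (hε : 0 < ε) : ∃ ξ : H, ‖ξ‖ = 1 ∧ ‖A ξ - t • ξ‖ < ε := by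
  by_contra! h
  rw [spectrum.mem_iff] at ht
  apply ht
  set B : H →L[ℂ] H := algebraMap ℝ (H →L[ℂ] H) t - A with hB
  have hBs : IsSelfAdjoint B := (IsSelfAdjoint.algebraMap _ (IsSelfAdjoint.all t)).sub hA
  have hBa : ∀ ξ, B ξ = -(A ξ - t • ξ) := fun ξ => by
    simp [hB, Algebra.algebraMap_eq_smul_one]
  have hbound : ∀ ξ, ε * ‖ξ‖ ≤ ‖B ξ‖ := by
    intro ξ
    rcases eq_or_ne ξ 0 with rfl | hξ
    · simp
    have hn : 0 < ‖ξ‖ := norm_pos_iff.2 hξ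
    have h1 := h (‖ξ‖⁻¹ • ξ) (by rw [norm_smul, norm_inv, norm_norm, inv_mul_cancel₀ hn.ne'])
    have h2 : A (‖ξ‖⁻¹ • ξ) - t • ‖ξ‖⁻¹ • ξ = ‖ξ‖⁻¹ • (A ξ - t • ξ) := by
      rw [smul_sub, smul_comm t, ContinuousLinearMap.map_smul_of_tower]
    rw [h2, norm_smul, norm_inv, norm_norm, ← norm_neg (A ξ - _), ← hBa, le_inv_mul_iff₀ hn] at h1
    linarith
  have hanti : AntilipschitzWith (Real.toNNReal ε⁻¹) B :=
    AddMonoidHomClass.antilipschitz_of_bound B fun ξ => by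
      rw [Real.coe_toNNReal _ (inv_nonneg.2 hε.le), inv_mul_eq_div, le_div_iff₀ hε, mul_comm]
      exact hbound ξ
  rw [ContinuousLinearMap.isUnit_iff_bijective,
    ContinuousLinearMap.bijective_iff_dense_range_and_antilipschitz]
  refine ⟨?_, _, hanti⟩
  rw [Submodule.topologicalClosure_eq_top_iff, ContinuousLinearMap.orthogonal_range,
    ContinuousLinearMap.isSelfAdjoint_iff'.1 hBs]
  exact LinearMap.ker_eq_bot.2 hanti.injective

/-- For exact eigenvectors `(a - b) ⟨ξ, z η⟩ = 0`. The case `z = 1` gives near-orthogonality of `ξ`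
and `η`. -/
theorem norm_inner_mul_abs_sub_le {A z : H →L[ℂ] H} (hA : IsSelfAdjoint A) (hz : A * z = z * A)
    {a b ε : ℝ} {ξ η : H} (hξ : ‖ξ‖ = 1) (hη : ‖η‖ = 1) (ha : ‖A ξ - a • ξ‖ ≤ ε)
    (hb : ‖A η - b • η‖ ≤ ε) : ‖inner ℂ ξ (z η)‖ * |a - b| ≤ 2 * ε * ‖z‖ := by
  have h1 : inner ℂ (A ξ) (z η) = inner ℂ ξ (z (A η)) := by
    have h2 : A (z η) = z (A η) := DFunLike.congr_fun hz η
    rw [← h2, ← ContinuousLinearMap.adjoint_inner_right,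
      ContinuousLinearMap.isSelfAdjoint_iff'.1 hA]
  have h3 : ((a - b : ℝ) : ℂ) * inner ℂ ξ (z η) =
      inner ℂ ξ (z (A η - b • η)) - inner ℂ (A ξ - a • ξ) (z η) := by
    rw [map_sub, inner_sub_right, inner_sub_left, h1, ContinuousLinearMap.map_smul_of_tower,
      ← Complex.coe_smul b, ← Complex.coe_smul a, inner_smul_right, inner_smul_left]
    simp
    ring
  have h4 := congrArg norm h3
  rw [norm_mul, Complex.norm_real, Real.norm_eq_abs] at h4
  rw [mul_comm, h4]
  have h5 : ‖inner ℂ ξ (z (A η - b • η))‖ ≤ ε * ‖z‖ := by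
    refine (norm_inner_le_norm _ _).trans ?_
    rw [hξ, one_mul, mul_comm]
    exact (z.le_opNorm _).trans (mul_le_mul_of_nonneg_left hb (norm_nonneg _))
  have h6 : ‖inner ℂ (A ξ - a • ξ) (z η)‖ ≤ ε * ‖z‖ := by
    refine (norm_inner_le_norm _ _).trans ?_
    have := z.le_opNorm η
    rw [hη, mul_one] at this
    exact mul_le_mul ha this (norm_nonneg _) ((norm_nonneg _).trans ha)
  refine (norm_sub_le _ _).trans ?_
  linarith

open InnerProductSpace in
theorem isCompactOperator_rankOne (ξ η : H) : IsCompactOperator (rankOne ℂ ξ η) := by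
  rw [rankOne_def']
  exact (isCompactOperator_of_locallyCompactSpace_rng
    (ContinuousLinearMap.toSpanSingleton ℂ ξ)).comp_clm (innerSL ℂ η)

open InnerProductSpace in
/-- The compact anti-hermitian operator `ξ ⊗ η* - η ⊗ ξ*`. -/
def skewRankOne (ξ η : H) : compactAntiHerm H :=
  ⟨rankOne ℂ ξ η - rankOne ℂ η ξ, by
    refine ⟨(isCompactOperator_rankOne ξ η).sub (isCompactOperator_rankOne η ξ), ?_⟩
    rw [star_sub, ContinuousLinearMap.star_eq_adjoint, ContinuousLinearMap.star_eq_adjoint,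
      adjoint_rankOne, adjoint_rankOne, neg_sub]⟩

open InnerProductSpace in
-- For exact eigenvectors the commutator is `b - a` times the rank-one operator; each approximate
-- eigenvector adds an error `ε`.
theorem norm_rankOne_commutator_le {A : H →L[ℂ] H} (hA : IsSelfAdjoint A) {a b ε : ℝ} {ξ η : H}
    (hξ : ‖ξ‖ = 1) (hη : ‖η‖ = 1) (ha : ‖A ξ - a • ξ‖ ≤ ε) (hb : ‖A η - b • η‖ ≤ ε) :
    ‖rankOne ℂ ξ η * A - A * rankOne ℂ ξ η‖ ≤ 2 * ε + |a - b| := by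
  have e : rankOne ℂ ξ η * A - A * rankOne ℂ ξ η =
      rankOne ℂ ξ (A η - b • η) - rankOne ℂ (A ξ - a • ξ) η - (a - b) • rankOne ℂ ξ η := by
    ext v
    have h1 : inner ℂ η (A v) = inner ℂ (A η) v := by
      rw [← ContinuousLinearMap.adjoint_inner_right, ContinuousLinearMap.isSelfAdjoint_iff'.1 hA]
    have h2 : inner ℂ (A η - b • η) v = inner ℂ (A η) v - (b : ℂ) * inner ℂ η v := by
      rw [inner_sub_left, ← Complex.coe_smul b, inner_smul_left]; simp
    simp only [sub_apply, mul_apply_eq_comp, rankOne_apply, smul_apply, h1, h2,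
      map_smul]
    simp only [← Complex.coe_smul]
    push_cast
    module
  rw [e]
  have h1 : ‖rankOne ℂ ξ (A η - b • η)‖ ≤ ε := by rw [norm_rankOne, hξ, one_mul]; exact hb
  have h2 : ‖rankOne ℂ (A ξ - a • ξ) η‖ ≤ ε := by rw [norm_rankOne, hη, mul_one]; exact ha
  have h3 : ‖(a - b) • rankOne ℂ ξ η‖ = |a - b| := by
    rw [norm_smul, norm_rankOne, hξ, hη, mul_one, mul_one, Real.norm_eq_abs]
  refine (norm_sub_le _ _).trans ?_
  rw [h3]
  linarith [norm_sub_le (rankOne ℂ ξ (A η - b • η)) (rankOne ℂ (A ξ - a • ξ) η)]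

theorem norm_commutatorMap_skewRankOne_le {A : H →L[ℂ] H} (hA : IsSelfAdjoint A) {a b ε : ℝ}
    {ξ η : H} (hξ : ‖ξ‖ = 1) (hη : ‖η‖ = 1) (ha : ‖A ξ - a • ξ‖ ≤ ε) (hb : ‖A η - b • η‖ ≤ ε) :
    ‖commutatorMap hA (skewRankOne ξ η)‖ ≤ 2 * (2 * ε + |a - b|) := by
  have h1 := norm_rankOne_commutator_le hA hξ hη ha hb
  have h2 := norm_rankOne_commutator_le hA hη hξ hb ha
  rw [abs_sub_comm] at h2
  change ‖(commutatorMap hA (skewRankOne ξ η)).1‖ ≤ _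
  rw [coe_commutatorMap, skewRankOne, sub_mul, mul_sub, sub_sub_sub_comm]
  refine (norm_sub_le _ _).trans ?_
  linarith

theorem finite_spectrum_of_generalizedInverse {A : H →L[ℂ] H} (hA : IsSelfAdjoint A)
    (G : compactHerm H →L[ℝ] compactAntiHerm H)
    (hG : ∀ x, commutatorMap hA (G (commutatorMap hA x)) = commutatorMap hA x) :
    (spectrum ℂ A).Finite := by
  have hfin : (spectrum ℝ A).Finite := by
    by_contra hinf
    obtain ⟨b, hb, hacc⟩ := Set.Infinite.exists_accPt_of_subset_isCompact hinf
      (spectrum.isCompact (𝕜 := ℝ) A) subset_rfl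
    set C := ‖G‖ with hC
    have hC0 : 0 ≤ C := norm_nonneg G
    rw [accPt_iff_nhds] at hacc
    -- With `d = |a - b| < 1 / (24 (C + 1))` and eigenvector errors `d / 20`, the commutator of `y`
    -- has norm at most `11 d / 5`, whence `‖x‖ ≤ 1 / 8`. Errors proportional to `d` survive the
    -- later division by `d`.
    obtain ⟨a, ⟨ha1, ha⟩, hab⟩ := hacc _ (Metric.ball_mem_nhds b
      (show (0 : ℝ) < 1 / (24 * (C + 1)) by positivity))
    have hd : 0 < |a - b| := abs_pos.2 (sub_ne_zero.2 hab)
    rw [Metric.mem_ball, Real.dist_eq, lt_div_iff₀ (by positivity)] at ha1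
    set d := |a - b| with hd'
    have hε : 0 < d / 20 := by positivity
    obtain ⟨ξ, hξ, hξa⟩ := exists_norm_sub_smul_lt hA ha hε
    obtain ⟨η, hη, hηb⟩ := exists_norm_sub_smul_lt hA hb hε
    set x := G (commutatorMap hA (skewRankOne ξ η)) with hx
    have hxn : ‖x.1‖ ≤ C * (2 * (2 * (d / 20) + d)) :=
      (G.le_opNorm _).trans (mul_le_mul_of_nonneg_left
        (norm_commutatorMap_skewRankOne_le hA hξ hη hξa.le hηb.le) hC0)
    have hxn' : ‖x.1‖ ≤ 1 / 8 := by nlinarith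
    set y := (skewRankOne ξ η).1 with hy
    have hcomm : A * (y - x.1) = (y - x.1) * A := by
      have := congrArg Subtype.val (hG (skewRankOne ξ η))
      rw [coe_commutatorMap, coe_commutatorMap, ← hx, ← hy] at this
      rw [sub_eq_sub_iff_add_eq_add] at this
      rw [mul_sub, sub_mul, sub_eq_sub_iff_add_eq_add, add_comm]
      exact this
    have hyn : ‖y‖ ≤ 2 := by
      refine (norm_sub_le _ _).trans ?_
      rw [InnerProductSpace.norm_rankOne, InnerProductSpace.norm_rankOne, hξ, hη]
      norm_num
    have hzn : ‖y - x.1‖ ≤ 17 / 8 := (norm_sub_le _ _).trans (by linarith)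
    have h1 := norm_inner_mul_abs_sub_le hA hcomm hξ hη hξa.le hηb.le
    have h2 := norm_inner_mul_abs_sub_le (z := 1) hA (by simp) hξ hη hξa.le hηb.le
    have h1' : ‖inner ℂ ξ ((y - x.1) η)‖ ≤ 17 / 80 := by
      rw [← hd'] at h1
      have : ‖inner ℂ ξ ((y - x.1) η)‖ * d ≤ 17 / 80 * d := by nlinarith
      exact le_of_mul_le_mul_right this hd
    have h2' : ‖inner ℂ ξ η‖ ≤ 1 / 10 := by
      rw [← hd'] at h2
      have h3 : ‖(1 : H →L[ℂ] H)‖ ≤ 1 := ContinuousLinearMap.norm_id_le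
      have : ‖inner ℂ ξ η‖ * d ≤ 1 / 10 * d := h2.trans (by nlinarith)
      exact le_of_mul_le_mul_right this hd
    have h3 : inner ℂ ξ (y η) = 1 - inner ℂ ξ η * inner ℂ ξ η := by
      rw [hy, skewRankOne]
      simp [inner_self_eq_norm_sq_to_K, hξ, hη]
    -- The three terms are bounded by `17 / 80`, `1 / 8` and `1 / 100`, whose sum is less than `1`.
    have h4 : (1 : ℂ) = inner ℂ ξ ((y - x.1) η) + inner ℂ ξ (x.1 η) +
        inner ℂ ξ η * inner ℂ ξ η := by
      rw [sub_apply, inner_sub_right, h3]; ring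
    have h5 : ‖inner ℂ ξ (x.1 η)‖ ≤ 1 / 8 := by
      refine (norm_inner_le_norm _ _).trans ?_
      have := x.1.le_opNorm η
      rw [hη, mul_one] at this
      rw [hξ, one_mul]
      linarith
    have h6 : ‖inner ℂ ξ η * inner ℂ ξ η‖ ≤ 1 / 100 := by
      rw [norm_mul]; nlinarith [norm_nonneg (inner ℂ ξ η)]
    have h7 := congrArg norm h4
    rw [norm_one] at h7
    have h8 := norm_add₃_le (a := inner ℂ ξ ((y - x.1) η)) (b := inner ℂ ξ (x.1 η))
      (c := inner ℂ ξ η * inner ℂ ξ η)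
    linarith
  have hres := hA.spectrumRestricts
  rw [← hres.algebraMap_image]
  exact hfin.image _

end FredholmOrbit

/-! ### One-sided inverses of the derivatives of submersions and immersions. -/

section Charts

variable {E E' M N : Type*} [NormedAddCommGroup E] [NormedSpace ℝ E] [NormedAddCommGroup E']
  [NormedSpace ℝ E'] [TopologicalSpace M] [ChartedSpace E M] [TopologicalSpace N]
  [ChartedSpace E' N] {n : ℕ∞ω} {f : M → N} {x : M}

theorem mdifferentiableAt_of_mem_maximalAtlas_of_ne_zero (hn : n ≠ 0)
    {φ : OpenPartialHomeomorph M E}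
    (hφ : φ ∈ IsManifold.maximalAtlas 𝓘(ℝ, E) n M) (hx : x ∈ φ.source) :
    MDifferentiableAt 𝓘(ℝ, E) 𝓘(ℝ, E) φ x :=
  ((contMDiffOn_of_mem_maximalAtlas hφ).contMDiffAt (φ.open_source.mem_nhds hx)).mdifferentiableAt
    hn

theorem mdifferentiableAt_symm_of_mem_maximalAtlas_of_ne_zero (hn : n ≠ 0)
    {φ : OpenPartialHomeomorph M E}
    (hφ : φ ∈ IsManifold.maximalAtlas 𝓘(ℝ, E) n M) {v : E} (hv : v ∈ φ.target) :
    MDifferentiableAt 𝓘(ℝ, E) 𝓘(ℝ, E) φ.symm v :=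
  ((contMDiffOn_symm_of_mem_maximalAtlas hφ).contMDiffAt
    (φ.open_target.mem_nhds hv)).mdifferentiableAt hn

namespace Manifold.IsSubmersionAt

/-- A submersion has a differentiable local section. -/
theorem exists_mdifferentiableAt_section (hn : n ≠ 0)
    (h : IsSubmersionAt 𝓘(ℝ, E) 𝓘(ℝ, E') n f x) :
    ∃ σ : N → M, σ (f x) = x ∧ MDifferentiableAt 𝓘(ℝ, E') 𝓘(ℝ, E) σ (f x) ∧
      f ∘ σ =ᶠ[nhds (f x)] id := by
  obtain ⟨F, _, _, ⟨φ, ψ, hx, hfx, hφ, hψ, hs, e, he⟩⟩ := h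
  have he' : ∀ v ∈ φ.target, ψ (f (φ.symm v)) = (e v).1 := fun v hv => he (by simpa using hv)
  set w : F := (e (φ x)).2
  have hbase : e.symm (ψ (f x), w) = φ x := by
    have := he' (φ x) (φ.map_source hx)
    rw [φ.left_inv hx] at this
    rw [this, Prod.mk.eta, e.symm_apply_apply]
  -- Freezing the fibre coordinate at its value `w` at `x` gives a section of the projection through
  -- `x`.
  let g : E' → E := fun v => e.symm (v, w)
  have hg : Differentiable ℝ g :=
    e.symm.differentiable.comp (differentiable_id.prodMk (differentiable_const w))
  have hgx : g (ψ (f x)) ∈ φ.target := by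
    change e.symm (ψ (f x), w) ∈ φ.target
    rw [hbase]; exact φ.map_source hx
  have hψd := mdifferentiableAt_of_mem_maximalAtlas_of_ne_zero hn hψ hfx
  refine ⟨fun y => φ.symm (g (ψ y)), ?_, ?_, ?_⟩
  · change φ.symm (e.symm (ψ (f x), w)) = x
    rw [hbase, φ.left_inv hx]
  · exact (mdifferentiableAt_symm_of_mem_maximalAtlas_of_ne_zero hn hφ hgx).comp (f x)
      ((hg (ψ (f x))).mdifferentiableAt.comp (f x) hψd)
  · have hc : ContinuousAt (fun y => g (ψ y)) (f x) :=
      hg.continuous.continuousAt.comp (ψ.continuousAt hfx)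
    filter_upwards [hc.preimage_mem_nhds (φ.open_target.mem_nhds hgx),
      ψ.open_source.mem_nhds hfx] with y hy1 hy2
    refine ψ.injOn (hs (φ.map_target hy1)) hy2 ?_
    change ψ (f (φ.symm (g (ψ y)))) = ψ y
    rw [he' _ hy1]
    simp [g]

/-- The derivative of a submersion has a right inverse. -/
theorem exists_rightInverse_mfderiv (hn : n ≠ 0) (h : IsSubmersionAt 𝓘(ℝ, E) 𝓘(ℝ, E') n f x) :
    ∃ R : E' →L[ℝ] E, ∀ v : E', mfderiv 𝓘(ℝ, E) 𝓘(ℝ, E') f x (R v) = v := by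
  obtain ⟨σ, h1, h2, h3⟩ := h.exists_mdifferentiableAt_section hn
  have hf : MDifferentiableAt 𝓘(ℝ, E) 𝓘(ℝ, E') f (σ (f x)) := by
    rw [h1]; exact h.contMDiffAt.mdifferentiableAt hn
  have h4 := mfderiv_comp (f x) hf h2
  rw [h3.mfderiv_eq, mfderiv_id, h1] at h4
  exact ⟨mfderiv 𝓘(ℝ, E') 𝓘(ℝ, E) σ (f x), fun v => (DFunLike.congr_fun h4 v).symm⟩

end Manifold.IsSubmersionAt

namespace Manifold.IsImmersionAt

/-- An immersion has a differentiable local retraction. -/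
theorem exists_mdifferentiableAt_retraction (hn : n ≠ 0)
    (h : IsImmersionAt 𝓘(ℝ, E) 𝓘(ℝ, E') n f x) :
    ∃ ρ : N → M, MDifferentiableAt 𝓘(ℝ, E') 𝓘(ℝ, E) ρ (f x) ∧ ρ ∘ f =ᶠ[nhds x] id := by
  obtain ⟨F, _, _, ⟨φ, ψ, hx, hfx, hφ, hψ, hs, e, he⟩⟩ := h
  have he' : ∀ v ∈ φ.target, ψ (f (φ.symm v)) = e (v, 0) := fun v hv => he (by simpa using hv)
  let g : E' → E := fun v => (e.symm v).1
  have hg : Differentiable ℝ g := differentiable_fst.comp e.symm.differentiable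
  have hgf : ∀ y ∈ φ.source, g (ψ (f y)) = φ y := fun y hy => by
    have := he' (φ y) (φ.map_source hy)
    rw [φ.left_inv hy] at this
    simp [g, this]
  have hgx : g (ψ (f x)) ∈ φ.target := by
    rw [hgf x hx]; exact φ.map_source hx
  refine ⟨fun y => φ.symm (g (ψ y)), ?_, ?_⟩
  · exact (mdifferentiableAt_symm_of_mem_maximalAtlas_of_ne_zero hn hφ hgx).comp (f x)
      ((hg (ψ (f x))).mdifferentiableAt.comp (f x)
        (mdifferentiableAt_of_mem_maximalAtlas_of_ne_zero hn hψ hfx))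
  · filter_upwards [φ.open_source.mem_nhds hx] with y hy
    change φ.symm (g (ψ (f y))) = y
    rw [hgf y hy, φ.left_inv hy]

/-- The derivative of an immersion has a left inverse. -/
theorem exists_leftInverse_mfderiv (hn : n ≠ 0) (h : IsImmersionAt 𝓘(ℝ, E) 𝓘(ℝ, E') n f x) :
    ∃ L : E' →L[ℝ] E, ∀ v : E, L (mfderiv 𝓘(ℝ, E) 𝓘(ℝ, E') f x v) = v := by
  obtain ⟨ρ, h2, h3⟩ := h.exists_mdifferentiableAt_retraction hn
  have h4 := mfderiv_comp x h2 (h.contMDiffAt.mdifferentiableAt hn)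
  rw [h3.mfderiv_eq, mfderiv_id] at h4
  exact ⟨mfderiv 𝓘(ℝ, E') 𝓘(ℝ, E) ρ (f x), fun v => (DFunLike.congr_fun h4 v).symm⟩

end Manifold.IsImmersionAt

end Charts

/-! ### The derivative at the identity, and necessity of finite spectrum. -/

namespace FredholmOrbit

variable {H : Type u} [NormedAddCommGroup H] [InnerProductSpace ℂ H] [CompleteSpace H]

/-- The identity as an element of `U_c(H)`. -/
def oneUnitary (H : Type u) [NormedAddCommGroup H] [InnerProductSpace ℂ H] [CompleteSpace H] :
    fredholmUnitary H :=
  cayleyInvUnitary 0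

theorem coe_oneUnitary : (oneUnitary H).1 = 1 := cayleyInv_zero

/-- In the Cayley chart at `1` and the translation chart, this map is `conjMap` with second variable
`0`. -/
theorem hasMFDerivAt_orbitInclusion_orbitMap {A : H →L[ℂ] H} (hA : IsSelfAdjoint A) :
    HasMFDerivAt 𝓘(ℝ, compactAntiHerm H) 𝓘(ℝ, compactHerm H)
      (orbitInclusion hA ∘ orbitMap A) (oneUnitary H) ((2 : ℝ) • commutatorMap hA) := by
  refine ⟨((isEmbedding_orbitInclusion hA).continuous.comp
    (continuous_orbitMap A)).continuousAt, ?_⟩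
  have h1 : extChartAt 𝓘(ℝ, compactAntiHerm H) (oneUnitary H) (oneUnitary H) = 0 := by
    apply Subtype.ext
    change cayley (star (oneUnitary H).1 * (oneUnitary H).1) = 0
    rw [coe_oneUnitary, star_one, one_mul, cayley, sub_self, zero_mul]
  have h2 : writtenInExtChartAt 𝓘(ℝ, compactAntiHerm H) 𝓘(ℝ, compactHerm H) (oneUnitary H)
      (orbitInclusion hA ∘ orbitMap A) = fun x => conjMap hA (x, 0) := by
    funext x
    change affineHermHomeo A (orbitInclusion hA (orbitMap A
      (mulUnitary (oneUnitary H) (cayleyInvUnitary x)))) = _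
    rw [affineHermHomeo_orbitInclusion]
    apply Subtype.ext
    change (oneUnitary H).1 * (A + (conjMap hA (x, 0)).1) * star (oneUnitary H).1 - A = _
    rw [coe_oneUnitary, star_one, one_mul, mul_one, add_sub_cancel_left]
  rw [h1, h2]
  refine HasFDerivAt.hasFDerivWithinAt ?_
  exact ((hasFDerivAt_conjMap hA).comp (f := fun x : compactAntiHerm H => (x, (0 : compactHerm H)))
    0 ((hasFDerivAt_id 0).prodMk (hasFDerivAt_const 0 0))).congr_fderiv
    (ContinuousLinearMap.ext fun x => by simp)

theorem finite_spectrum_of_isSubmersion {A : H →L[ℂ] H} (hA : IsSelfAdjoint A) {n : ℕ∞}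
    (hn : 1 ≤ n) {E : Type u} [NormedAddCommGroup E] [NormedSpace ℝ E] [ChartedSpace E (orbit A)]
    (h1 : Manifold.IsSmoothEmbedding 𝓘(ℝ, E) 𝓘(ℝ, compactHerm H) n (orbitInclusion hA))
    (h2 : Manifold.IsSubmersion 𝓘(ℝ, compactAntiHerm H) 𝓘(ℝ, E) n (orbitMap A)) :
    (spectrum ℂ A).Finite := by
  have hn' : (n : ℕ∞ω) ≠ 0 := by
    rintro h
    have : n = 0 := by exact_mod_cast h
    simp [this] at hn
  have hi := h1.isImmersion.isImmersionAt (orbitMap A (oneUnitary H))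
  have hs := h2.isSubmersionAt (oneUnitary H)
  obtain ⟨L, hL⟩ := hi.exists_leftInverse_mfderiv hn'
  obtain ⟨R, hR⟩ := hs.exists_rightInverse_mfderiv hn'
  have hc := mfderiv_comp (oneUnitary H) (hi.contMDiffAt.mdifferentiableAt hn')
    (hs.contMDiffAt.mdifferentiableAt hn')
  rw [(hasMFDerivAt_orbitInclusion_orbitMap hA).mfderiv] at hc
  have hT : ∀ v, (2 : ℝ) • commutatorMap hA v = mfderiv 𝓘(ℝ, E) 𝓘(ℝ, compactHerm H)
      (orbitInclusion hA) (orbitMap A (oneUnitary H))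
      (mfderiv 𝓘(ℝ, compactAntiHerm H) 𝓘(ℝ, E) (orbitMap A) (oneUnitary H) v) :=
    fun v => DFunLike.congr_fun hc v
  -- Since `2 T` is the composite of the two derivatives, `(2 T) R L (2 T) = 2 T`; dividing by 2
  -- leaves `T (2 R L) T = T`.
  refine finite_spectrum_of_generalizedInverse hA ((2 : ℝ) • R ∘L L) fun x => ?_
  have h3 : (2 : ℝ) • commutatorMap hA (R (L ((2 : ℝ) • commutatorMap hA x))) =
      (2 : ℝ) • commutatorMap hA x := by
    rw [hT (R _), hR, hT x]
    exact congrArg (mfderiv 𝓘(ℝ, E) 𝓘(ℝ, compactHerm H) (orbitInclusion hA)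
      (orbitMap A (oneUnitary H))) (hL _)
  have h4 : (2 : ℝ) • (commutatorMap hA (((2 : ℝ) • R ∘L L) (commutatorMap hA x)) -
      commutatorMap hA x) = 0 := by
    rw [smul_sub, sub_eq_zero, ← h3]
    simp
  exact sub_eq_zero.1 ((smul_eq_zero.1 h4).resolve_left two_ne_zero)

end FredholmOrbit

end

open FredholmOrbit in
theorem theorem4p4 {H : Type u} [NormedAddCommGroup H] [InnerProductSpace ℂ H] [CompleteSpace H]
    (A : H →L[ℂ] H) (hA : IsSelfAdjoint A) (n : ℕ∞) (hn : 1 ≤ n) :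
    (∃ (E : Type u) (_ : NormedAddCommGroup E) (_ : NormedSpace ℝ E)
        (_ : ChartedSpace E (orbit A)),
      IsManifold 𝓘(ℝ, E) n (orbit A) ∧
      Manifold.IsSmoothEmbedding 𝓘(ℝ, E) 𝓘(ℝ, compactHerm H) n (orbitInclusion hA) ∧
      Manifold.IsSubmersion 𝓘(ℝ, compactAntiHerm H) 𝓘(ℝ, E) n (orbitMap A)) ↔
    (spectrum ℂ A).Finite :=
  ⟨fun ⟨_, _, _, _, _, h1, h2⟩ => finite_spectrum_of_isSubmersion hA hn h1 h2,
    exists_chartedSpace_of_finite_spectrum hA n⟩
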